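/- **Setting.** Consider a Gaussian linear bandit with $K\ge 2$ arms: arm $i\in[K]$ has a feature vector $a_i\in\mathbb R^d$ and reward law $\mathcal N(m_i,\sigma_i^2)$, $m_i=a_i^\top\theta$, $\sigma_i>0$, with a unique best arm $I^*$. Let $\mathcal X=[K]\setminus\{I^*\}$, and let $\Delta_K,\Delta_{\mathcal X}$ be the probability simplices. For $x\in\mathcal X$ and $p\in\mathbb R^K_{\ge0}$ put $$D(p,x)=\inf\Bigl\{\sum_i p_i\,\mathrm{KL}\bigl(\mathcal N(a_i^\top\theta,\sigma_i^2)\,\|\,\mathcal N(a_i^\top\vartheta,\sigma_i^2)\bigr):\ a_{I^*}^\top\vartheta<a_x^\top\vartheta\Bigr\},\qquad F(p,\mu)=\sum_{x\in\mathcal X}\mu_xD(p,x).$$ Let $\mathcal D_F\subset\Delta_K\times\Delta_{\mathcal X}$ be the set of points where $F$ is differentiable (relative to $\mathbb R^K_{\ge 0}$ in $p$), let $\partial_p^\circ F(p,\mu)$ be the convex hull of all limits $\lim_n\nabla_pF(p^n,\mu^n)$ with $\mathcal D_F\ni(p^n,\mu^n)\to(p,\mu)$, and let $$\mathrm{LMO}_p(p,\mu)=\mathrm{conv}\bigl\{q\in\Delta_K:\exists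 f\in\partial_p^\circ F(p,\mu),\ q\in\arg\max_{q'\in\Delta_K}q'^\top f\bigr\},\qquad \mathrm{LMO}_\mu(p,\mu)=\arg\min_{\nu\in\Delta_{\mathcal X}}\nu^\top\nabla_\mu F(p,\mu).$$ A *solution* is a locally absolutely continuous $(p,\mu):[0,\infty)\to\Delta_K\times\Delta_{\mathcal X}$ with $\dot p\in\mathrm{LMO}_p(p,\mu)-p$ and $\dot\mu\in\mathrm{LMO}_\mu(p,\mu)-\mu$ for almost every $t$; its initial condition in $\Delta_K\times\Delta_{\mathcal X}$ is arbitrary. Put $\delta_x=a_{I^*}-a_x$, $\mathcal H=\mathrm{span}\{a_i\}$, $\mathcal S_p=\mathrm{span}\{a_i:p_i>0\}$, $\mathcal Z(p)=\{x:D(p,x)=0\}$. For a subspace $\mathcal S\subsetneq\mathcal H$ spanned by arms let $O(\mathcal S)=\{j:a_j\notin\mathcal S\}$, $$\gamma(\mathcal S)=\min_{u\in\mathcal S^\perp\cap\mathcal H,\ \|u\|=1}\ \max_{j\in O(\mathcal S)}\frac{(a_j^\top u)^2}{\sigma_j^{2}},\qquad \rho(\mathcal S)=\max_{x\in\mathcal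 X}\|\mathrm{Proj}_{\mathcal S^\perp}\delta_x\|^2,\qquad m(\mathcal S)=\frac{\min_{x\in\mathcal X}(m_{I^*}-m_x)^2}{2}\,\frac{\gamma(\mathcal S)}{\rho(\mathcal S)}.$$ For a constant $M_p$ with $\|\nabla_pD(p,x)\|_\infty\le M_p$ for all $x\in\mathcal X$ and all $p\in\Delta_K$ at which $D(\cdot,x)$ is differentiable, let $$\varepsilon_{\mathcal S}=\min\Bigl\{\frac12,\ \frac{m(\mathcal S)}{4\,|O(\mathcal S)|\,M_p}\Bigr\},\qquad T_{\mathcal S}=\log(1/\varepsilon_{\mathcal S}).$$ **Theorem.** Such a finite $M_p$ exists, and for every such $M_p$ the following holds. For every solution there are $r\ge0$, a strictly increasing chain $$\mathcal S_{p(0)}=\mathcal S_0\subsetneq\mathcal S_1\subsetneq\cdots\subsetneq\mathcal S_r=\mathcal H,\qquad r\le\mathrm{rank}\{\delta_x:x\in\mathcal X\}\le\dim\mathcal H,$$ with $r=0$ if and only if $\mathcal Z(p(0))=\varnothing$, and times $0=\tau_0\le\tau_1<\tau_2<\cdots<\tau_r$ such that for each $\ell<r$: (i) $\mathcal S_{p(t)}=\mathcal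 S_\ell$ and $\mathcal Z(p(t))\ne\varnothing$ for $t\in(\tau_\ell,\tau_{\ell+1}]$ (and for $t=0$ if $\ell=0$), while $\mathcal S_{p(t)}=\mathcal H$ for $t>\tau_r$; (ii) $\tau_{\ell+1}-\tau_\ell\le T_{\mathcal S_\ell}+\log2$. Consequently, for all $t\ge T^*:=\sum_{\ell=0}^{r-1}(T_{\mathcal S_\ell}+\log 2)$ we have $\mathcal S_{p(t)}=\mathcal H$, $\mathcal Z(p(t))=\varnothing$, i.e. $D(p(t),x)>0$ for all $x\in\mathcal X$, and $F$ is differentiable at $(p(t),\mu(t))$. The times $T^*$ are bounded by a constant that does not depend on the solution. Finally, the game has a Nash equilibrium $(p^*,\mu^*)$, and with $F^*=F(p^*,\mu^*)$ the game value converges uniformly: for every $\varepsilon>0$ there is $T$ such that $|F(p(t),\mu(t))-F^*|\le\varepsilon$ for every solution and every $t\ge T$. -/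

import Mathlib

open Set Filter Topology MeasureTheory ProbabilityTheory
open scoped NNReal ENNReal

/-- A Gaussian linear bandit with `K` arms and a unique best arm: arm `i` has feature vector `a i`,
and pulling it gives a reward with law `𝒩(⟨a i, θ⟩, σ i ^ 2)`. -/
structure LinearBandit (K d : ℕ) where
  /-- feature vectors -/
  a : Fin K → EuclideanSpace ℝ (Fin d)
  /-- true parameter -/
  θ : EuclideanSpace ℝ (Fin d)
  /-- standard deviations of the noise -/
  σ : Fin K → ℝ≥0
  σ_pos : ∀ i, 0 < σ i
  /-- the best arm -/
  best : Fin K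
  best_unique : ∀ x, x ≠ best → inner ℝ (a x) θ < inner ℝ (a best) θ

namespace LinearBandit

noncomputable section

variable {K d : ℕ} (B : LinearBandit K d)

/-- Confusing scenarios: the arms other than the best one. -/
abbrev Scenario : Type := {x : Fin K // x ≠ B.best}

/-- Law of a reward of arm `i` under the parameter `ϑ`. -/
def armLaw (ϑ : EuclideanSpace ℝ (Fin d)) (i : Fin K) : Measure ℝ :=
  gaussianReal (inner ℝ (B.a i) ϑ) (B.σ i ^ 2)

/-- Parameters under which arm `x` beats the true best arm. -/
def alt (x : B.Scenario) : Set (EuclideanSpace ℝ (Fin d)) :=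
  {ϑ | inner ℝ (B.a B.best) ϑ < inner ℝ (B.a x) ϑ}

/-- `Γ(p, ϑ) = ∑ i, p i * KL(P_{θ,i} ‖ P_{ϑ,i})`. -/
def info (p : Fin K → ℝ) (ϑ : EuclideanSpace ℝ (Fin d)) : ℝ :=
  ∑ i, p i * (InformationTheory.klDiv (B.armLaw B.θ i) (B.armLaw ϑ i)).toReal

/-- `D(p, x) = inf_{ϑ ∈ Alt_x} Γ(p, ϑ)`. It is only used on the nonnegative orthant. -/
def D (p : Fin K → ℝ) (x : B.Scenario) : ℝ :=
  sInf (B.info p '' B.alt x)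

/-- Mixed payoff `F(p, μ) = ∑ x, μ x * D(p, x)`. -/
def F (p : Fin K → ℝ) (μ : B.Scenario → ℝ) : ℝ :=
  ∑ x, μ x * B.D p x

/-- The nonnegative orthant, the domain of the payoffs `D(·, x)`. -/
def orthant (K : ℕ) : Set (Fin K → ℝ) := {p | ∀ i, 0 ≤ p i}

/-- The points of `Δ_K × Δ_𝒳` at which `F` is differentiable (relative to the orthant in `p`). -/
def diffSet : Set ((Fin K → ℝ) × (B.Scenario → ℝ)) :=
  {z | z.1 ∈ stdSimplex ℝ (Fin K) ∧ z.2 ∈ stdSimplex ℝ B.Scenario ∧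
    DifferentiableWithinAt ℝ (fun w : (Fin K → ℝ) × (B.Scenario → ℝ) => B.F w.1 w.2)
      (orthant K ×ˢ univ) z}

/-- The gradient of `F` in `p`. -/
def gradP (p : Fin K → ℝ) (μ : B.Scenario → ℝ) : Fin K → ℝ :=
  fun i => fderivWithin ℝ (fun q => B.F q μ) (orthant K) p (Pi.single i 1)

/-- The gradient of `F` in `μ`. -/
def gradMu (p : Fin K → ℝ) (μ : B.Scenario → ℝ) : B.Scenario → ℝ :=
  fun x => fderiv ℝ (fun ν => B.F p ν) μ (Pi.single x 1)

/-- The Clarke generalized gradient of `F` in `p`. -/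
def clarkeP (p : Fin K → ℝ) (μ : B.Scenario → ℝ) : Set (Fin K → ℝ) :=
  convexHull ℝ {f | ∃ z : ℕ → (Fin K → ℝ) × (B.Scenario → ℝ),
    (∀ n, z n ∈ B.diffSet) ∧ Tendsto z atTop (𝓝 (p, μ)) ∧
    Tendsto (fun n => B.gradP (z n).1 (z n).2) atTop (𝓝 f)}

/-- Linear oracle of the maximizing player. -/
def LMOp (p : Fin K → ℝ) (μ : B.Scenario → ℝ) : Set (Fin K → ℝ) :=
  convexHull ℝ {q | q ∈ stdSimplex ℝ (Fin K) ∧ ∃ f ∈ B.clarkeP p μ,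
    ∀ q' ∈ stdSimplex ℝ (Fin K), ∑ i, q' i * f i ≤ ∑ i, q i * f i}

/-- Linear oracle of the minimizing player. -/
def LMOmu (p : Fin K → ℝ) (μ : B.Scenario → ℝ) : Set (B.Scenario → ℝ) :=
  {ν | ν ∈ stdSimplex ℝ B.Scenario ∧ ∀ ν' ∈ stdSimplex ℝ B.Scenario,
    ∑ x, ν x * B.gradMu p μ x ≤ ∑ x, ν' x * B.gradMu p μ x}

/-- `(p, μ)` is an absolutely continuous solution on `[0, ∞)`, with values in `Δ_K × Δ_𝒳`, of the
differential inclusion `p' ∈ LMOp(p, μ) - p`, `μ' ∈ LMOmu(p, μ) - μ`. -/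
structure IsSolution (p : ℝ → Fin K → ℝ) (μ : ℝ → B.Scenario → ℝ) : Prop where
  mem_p : ∀ t, 0 ≤ t → p t ∈ stdSimplex ℝ (Fin K)
  mem_mu : ∀ t, 0 ≤ t → μ t ∈ stdSimplex ℝ B.Scenario
  ac_p : ∀ T, 0 < T → AbsolutelyContinuousOnInterval p 0 T
  ac_mu : ∀ T, 0 < T → AbsolutelyContinuousOnInterval μ 0 T
  inclusion : ∀ᵐ t ∂(volume.restrict (Ioi (0 : ℝ))),
    ∃ q ∈ B.LMOp (p t) (μ t), ∃ ν ∈ B.LMOmu (p t) (μ t),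
      HasDerivAt p (q - p t) t ∧ HasDerivAt μ (ν - μ t) t

/-- Nash equilibrium of the game on `Δ_K × Δ_𝒳` with payoff `F`. -/
def IsNash (p : Fin K → ℝ) (μ : B.Scenario → ℝ) : Prop :=
  p ∈ stdSimplex ℝ (Fin K) ∧ μ ∈ stdSimplex ℝ B.Scenario ∧
  (∀ q ∈ stdSimplex ℝ (Fin K), B.F q μ ≤ B.F p μ) ∧
  (∀ ν ∈ stdSimplex ℝ B.Scenario, B.F p μ ≤ B.F p ν)

/-- `M` bounds the partial derivatives of all `D(·, x)` at all points of differentiability. -/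
def IsGradientBound (M : ℝ) : Prop :=
  ∀ x : B.Scenario, ∀ p ∈ stdSimplex ℝ (Fin K),
    DifferentiableWithinAt ℝ (fun q => B.D q x) (orthant K) p →
    ∀ i, |fderivWithin ℝ (fun q => B.D q x) (orthant K) p (Pi.single i 1)| ≤ M

/-- `δ_x = a_{I*} - a_x`. -/
def delta (x : B.Scenario) : EuclideanSpace ℝ (Fin d) := B.a B.best - B.a x

/-- The span `ℋ` of all features. -/
def fullSpan : Submodule ℝ (EuclideanSpace ℝ (Fin d)) := Submodule.span ℝ (range B.a)

/-- The active feature span `𝒮_p`. -/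
def activeSpan (p : Fin K → ℝ) : Submodule ℝ (EuclideanSpace ℝ (Fin d)) :=
  Submodule.span ℝ (B.a '' {i | 0 < p i})

/-- The zero-information scenarios `𝒵(p)`. -/
def zeroInfo (p : Fin K → ℝ) : Set B.Scenario := {x | B.D p x = 0}

/-- The arms `O(S)` whose features lie outside `S`. -/
abbrev Outside (S : Submodule ℝ (EuclideanSpace ℝ (Fin d))) : Type := {j : Fin K // B.a j ∉ S}

/-- The smallest gap between the mean of the best arm and that of another arm. -/
def gapMin : ℝ := ⨅ x : B.Scenario, (inner ℝ (B.a B.best) B.θ - inner ℝ (B.a x) B.θ)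

/-- `γ(S)`: minimum over unit vectors `u ∈ Sᗮ ∩ ℋ` of `max_{j ∈ O(S)} σ_j⁻² ⟨a_j, u⟩²`. -/
def gam (S : Submodule ℝ (EuclideanSpace ℝ (Fin d))) : ℝ :=
  ⨅ u : {u : EuclideanSpace ℝ (Fin d) // u ∈ Sᗮ ⊓ B.fullSpan ∧ ‖u‖ = 1},
    ⨆ j : B.Outside S, (inner ℝ (B.a j) (u : EuclideanSpace ℝ (Fin d))) ^ 2 / (B.σ j : ℝ) ^ 2

/-- `ρ(S)`: maximum over `x` of the squared norm of the projection of `δ_x` to `Sᗮ`. -/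
def rho (S : Submodule ℝ (EuclideanSpace ℝ (Fin d))) : ℝ :=
  ⨆ x : B.Scenario, ‖Sᗮ.starProjection (B.delta x)‖ ^ 2

/-- `m(S) = (gapMin² / 2) * γ(S) / ρ(S)`. -/
def mconst (S : Submodule ℝ (EuclideanSpace ℝ (Fin d))) : ℝ :=
  B.gapMin ^ 2 / 2 * (B.gam S / B.rho S)

/-- `ε_S = min {1/2, m(S) / (4 |O(S)| M)}`. -/
def epsS (M : ℝ) (S : Submodule ℝ (EuclideanSpace ℝ (Fin d))) : ℝ :=
  min (1 / 2) (B.mconst S / (4 * (Nat.card (B.Outside S) : ℝ) * M))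

/-- `T_S = log (1 / ε_S)`. -/
def timeS (M : ℝ) (S : Submodule ℝ (EuclideanSpace ℝ (Fin d))) : ℝ :=
  Real.log (1 / B.epsS M S)

/-- `T* = ∑_{ℓ < r} (T_{S_ℓ} + log 2)`. -/
def timeStar (M : ℝ) (r : ℕ) (S : ℕ → Submodule ℝ (EuclideanSpace ℝ (Fin d))) : ℝ :=
  ∑ l ∈ Finset.range r, (B.timeS M (S l) + Real.log 2)

end

end LinearBandit

/-! The information of an allocation is a quadratic form (`energy`) in the mean shifts produced by a
change of parameter, and `D p x` is its minimum over the shifts that close the gap of `x` exactly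
(`D_eq_energy`). The minimizers at positive weights are bounded uniformly in the weights
(`exists_bound_isMinimizer_of_pos`), so limits give minimizers on the boundary of the orthant too.
Every gradient limit, hence the Clarke gradient, is then described by rates of bounded minimizers
(`exists_minimizers_gradP_eq`, `clarkeP_subset`).

Expansion. `D p x = 0` exactly when `δ_x` lies outside the active span `S`. Weights decay at most
like `exp (-t)`, so `S` never shrinks. As long as `S` is a fixed proper subspace, the adversary's
oracle charges only zero-information scenarios, and the mass of the others decays like `exp (-t)`.
Once that mass is at most `ε_S`, arms in `S` have gradient at most `ε_S * M`, while some arm outside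
has a larger one, because a shift invisible to `S` yet closing a gap is seen by an outside arm at
rate at least `m(S)` (`exists_mconst_le_rate`). The oracle then plays only outside arms, which
contradicts their weights being identically zero. So `S` lasts at most `T_S` (`sub_le_timeS`);
strict growth of dimension bounds the number of epochs.

Convergence. At full span the energy is coercive, minimizers are unique and Lipschitz in the weights
along the trajectory, and `F` is differentiable. The duality gap (largest gradient coordinate minus
smallest information) dominates the distance of the payoff to the game value (`abs_F_sub_le`). By
envelope arguments and concavity of `D` in the weights, its derivative is at most minus itself
(`deriv_gap_le`). It therefore decays exponentially from a uniformly bounded value at a uniform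
time. -/

/-- The Kullback–Leibler divergence of two Gaussians with the same variance. -/
theorem toReal_klDiv_gaussianReal (m₁ m₂ : ℝ) {v : ℝ≥0} (hv : v ≠ 0) :
    (InformationTheory.klDiv (gaussianReal m₁ v) (gaussianReal m₂ v)).toReal =
      (m₁ - m₂) ^ 2 / (2 * v) := by
  have hv0 : (0 : ℝ) < v := by positivity
  -- With equal variances the log-likelihood ratio is affine, so the divergence is its value at the
  -- mean `m₁`.
  set r : ℝ → ℝ := fun x => (m₁ - m₂) * (2 * x - m₁ - m₂) / (2 * v) with hr
  have hrm : Measurable fun x => ENNReal.ofReal (Real.exp (r x)) := by fun_prop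
  have hdens : gaussianReal m₁ v =
      (gaussianReal m₂ v).withDensity fun x => ENNReal.ofReal (Real.exp (r x)) := by
    rw [gaussianReal_of_var_ne_zero _ hv, gaussianReal_of_var_ne_zero _ hv,
      ← withDensity_mul _ (measurable_gaussianPDF _ _) hrm]
    congr 1
    ext x
    rw [Pi.mul_apply, gaussianPDF, gaussianPDF, ← ENNReal.ofReal_mul (gaussianPDFReal_nonneg _ _ _),
      gaussianPDFReal, gaussianPDFReal, mul_assoc _ (Real.exp _) (Real.exp _), ← Real.exp_add]
    congr 3
    simp only [hr]
    field_simp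
    ring
  have hac : gaussianReal m₁ v ≪ gaussianReal m₂ v := by
    rw [hdens]; exact withDensity_absolutelyContinuous _ _
  have hllr : llr (gaussianReal m₁ v) (gaussianReal m₂ v) =ᵐ[gaussianReal m₁ v] r := by
    refine hac.ae_eq ?_
    have h := Measure.rnDeriv_withDensity (gaussianReal m₂ v) hrm
    rw [← hdens] at h
    filter_upwards [h] with x hx
    rw [llr, hx, ENNReal.toReal_ofReal (Real.exp_pos _).le, Real.log_exp]
  rw [InformationTheory.toReal_klDiv_of_measure_eq hac (by simp), integral_congr_ae hllr]
  have hint : Integrable (fun x : ℝ => x) (gaussianReal m₁ v) :=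
    (memLp_id_gaussianReal 1).integrable (by simp)
  have hr' : r = fun x => (m₁ - m₂) / v * x - (m₁ - m₂) * (m₁ + m₂) / (2 * v) := by
    ext x; simp only [hr]; field_simp; ring
  rw [hr', integral_sub (hint.const_mul _) (integrable_const _), integral_const_mul,
    integral_id_gaussianReal]
  simp
  field_simp
  ring

/-! ### Mean shifts, information energy and the formula for `D` -/

namespace LinearBandit

noncomputable section

variable {K d : ℕ} (B : LinearBandit K d)

/-- The mean shifts of all arms caused by a change `h` of the parameter. -/
def response : EuclideanSpace ℝ (Fin d) →ₗ[ℝ] (Fin K → ℝ) where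
  toFun h i := inner ℝ (B.a i) h
  map_add' h k := by ext i; simp [inner_add_right]
  map_smul' r h := by ext i; simp [inner_smul_right]

@[simp] theorem response_apply (h : EuclideanSpace ℝ (Fin d)) (i : Fin K) :
    B.response h i = inner ℝ (B.a i) h := rfl

/-- The information rates of the arms for the mean shifts `y`. -/
def rate (y : Fin K → ℝ) (i : Fin K) : ℝ := y i ^ 2 / (2 * (B.σ i : ℝ) ^ 2)

/-- The information collected with allocation `p` about the mean shifts `y`. -/
def energy (p y : Fin K → ℝ) : ℝ := ∑ i, p i * B.rate y i

/-- The polarization of `LinearBandit.energy`. -/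
def cross (p y z : Fin K → ℝ) : ℝ := ∑ i, p i * (y i * z i / (2 * (B.σ i : ℝ) ^ 2))

/-- The gap of arm `x`. -/
def gap (x : B.Scenario) : ℝ := inner ℝ (B.delta x) B.θ

/-- The mean shifts that make the gap of `x` vanish. -/
def slice (x : B.Scenario) : Set (Fin K → ℝ) :=
  {y | ∃ h, B.response h = y ∧ inner ℝ (B.delta x) h = B.gap x}

/-- `y` is a least informative mean shift confusing `x` with the best arm. -/
def IsMinimizer (p : Fin K → ℝ) (x : B.Scenario) (y : Fin K → ℝ) : Prop :=
  y ∈ B.slice x ∧ ∀ y' ∈ B.slice x, B.energy p y ≤ B.energy p y'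

theorem σ_pos' (i : Fin K) : (0 : ℝ) < B.σ i := by exact_mod_cast B.σ_pos i

theorem rate_nonneg (y : Fin K → ℝ) (i : Fin K) : 0 ≤ B.rate y i := by
  unfold rate; positivity

theorem energy_nonneg {p : Fin K → ℝ} (hp : p ∈ orthant K) (y : Fin K → ℝ) :
    0 ≤ B.energy p y :=
  Finset.sum_nonneg fun i _ => mul_nonneg (hp i) (B.rate_nonneg y i)

theorem gap_pos (x : B.Scenario) : 0 < B.gap x := by
  have := B.best_unique x x.2
  simp only [gap, delta, inner_sub_left]
  linarith

theorem inner_delta (x : B.Scenario) (h : EuclideanSpace ℝ (Fin d)) :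
    inner ℝ (B.delta x) h = B.response h B.best - B.response h x := by
  simp [delta, inner_sub_left]

theorem continuous_rate : Continuous B.rate := by
  unfold rate; fun_prop

theorem continuous_energy : Continuous fun z : (Fin K → ℝ) × (Fin K → ℝ) => B.energy z.1 z.2 := by
  unfold energy rate; fun_prop

theorem energy_add_smul (p y z : Fin K → ℝ) (t : ℝ) :
    B.energy p (y + t • z) = B.energy p y + 2 * t * B.cross p y z + t ^ 2 * B.energy p z := by
  simp only [energy, cross, rate, Finset.mul_sum, ← Finset.sum_add_distrib]
  refine Finset.sum_congr rfl fun i _ => ?_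
  simp only [Pi.add_apply, Pi.smul_apply, smul_eq_mul]
  ring

theorem energy_smul (p y : Fin K → ℝ) (t : ℝ) : B.energy p (t • y) = t ^ 2 * B.energy p y := by
  simp only [energy, rate, Finset.mul_sum]
  refine Finset.sum_congr rfl fun i _ => ?_
  simp only [Pi.smul_apply, smul_eq_mul]
  ring

theorem info_eq_energy (p : Fin K → ℝ) (ϑ : EuclideanSpace ℝ (Fin d)) :
    B.info p ϑ = B.energy p (B.response (B.θ - ϑ)) := by
  refine Finset.sum_congr rfl fun i _ => ?_
  have hσ : B.σ i ^ 2 ≠ 0 := pow_ne_zero _ (B.σ_pos i).ne'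
  rw [armLaw, armLaw, toReal_klDiv_gaussianReal _ _ hσ, rate, response_apply, inner_sub_right]
  simp

theorem slice_nonempty (x : B.Scenario) : (B.slice x).Nonempty :=
  ⟨B.response B.θ, B.θ, rfl, rfl⟩

/-- A confusing parameter overshoots the gap; shrinking its shift back to the slice multiplies the
energy by a factor at most one. Conversely, stretching a minimizer by any `t > 1` gives a confusing
parameter, and `t → 1` recovers its energy. -/
theorem D_eq_energy {p : Fin K → ℝ} (hp : p ∈ orthant K) {x : B.Scenario} {y : Fin K → ℝ}
    (hy : B.IsMinimizer p x y) : B.D p x = B.energy p y := by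
  have hg := B.gap_pos x
  refine IsGLB.csInf_eq ⟨?_, ?_⟩ ?_
  · rintro _ ⟨ϑ, hϑ, rfl⟩
    rw [info_eq_energy]
    set h := B.θ - ϑ with hh
    have hs : B.gap x < inner ℝ (B.delta x) h := by
      have : inner ℝ (B.a B.best) ϑ < inner ℝ (B.a x) ϑ := hϑ
      simp only [gap, hh, inner_sub_right, delta, inner_sub_left]
      linarith
    set s := inner ℝ (B.delta x) h
    have hs0 : 0 < s := hg.trans hs
    have hmem : (B.gap x / s) • B.response h ∈ B.slice x :=
      ⟨(B.gap x / s) • h, map_smul _ _ _, by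
        rw [inner_smul_right]; exact div_mul_cancel₀ _ hs0.ne'⟩
    refine (hy.2 _ hmem).trans ?_
    rw [energy_smul]
    have h1 : B.gap x / s ≤ 1 := (div_le_one hs0).2 hs.le
    have h0 : 0 ≤ B.gap x / s := by positivity
    have := B.energy_nonneg hp (B.response h)
    have : (B.gap x / s) ^ 2 ≤ 1 := pow_le_one₀ h0 h1
    nlinarith
  · intro b hb
    obtain ⟨h, rfl, hh⟩ := hy.1
    have key : ∀ t : ℝ, 1 < t → b ≤ t ^ 2 * B.energy p (B.response h) := by
      intro t ht
      have := hb ⟨B.θ - t • h, ?_, rfl⟩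
      · rwa [info_eq_energy, sub_sub_cancel, map_smul, energy_smul] at this
      · have h1 : inner ℝ (B.delta x) (B.θ - t • h) < 0 := by
          rw [inner_sub_right, inner_smul_right, hh]
          change B.gap x - t * B.gap x < 0
          nlinarith
        simp only [delta, inner_sub_left] at h1
        change inner ℝ (B.a B.best) (B.θ - t • h) < inner ℝ (B.a x) (B.θ - t • h)
        linarith
    have hlim : Tendsto (fun t : ℝ => t ^ 2 * B.energy p (B.response h)) (𝓝[>] 1)
        (𝓝 (1 ^ 2 * B.energy p (B.response h))) := by
      refine Tendsto.mono_left ?_ nhdsWithin_le_nhds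
      exact Continuous.tendsto (f := fun t : ℝ => t ^ 2 * B.energy p (B.response h)) (by fun_prop) 1
    have := ge_of_tendsto hlim (eventually_mem_nhdsWithin.mono fun t ht => key t ht)
    simpa using this
  -- The parameter `-θ` reverses every comparison of arms, so the infimum is over a nonempty set.
  · refine Set.Nonempty.image _ ⟨B.θ - (2 : ℝ) • B.θ, ?_⟩
    have h1 := B.best_unique x x.2
    change inner ℝ (B.a B.best) (B.θ - (2 : ℝ) • B.θ) < inner ℝ (B.a x) (B.θ - (2 : ℝ) • B.θ)
    simp only [inner_sub_right, inner_smul_right]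
    linarith

theorem mem_slice_iff {x : B.Scenario} {y : Fin K → ℝ} :
    y ∈ B.slice x ↔ y ∈ LinearMap.range B.response ∧ y B.best - y x = B.gap x := by
  constructor
  · rintro ⟨h, rfl, hh⟩
    exact ⟨⟨h, rfl⟩, by rw [← inner_delta, hh]⟩
  · rintro ⟨⟨h, rfl⟩, hh⟩
    exact ⟨h, rfl, by rw [inner_delta, hh]⟩

theorem isClosed_range_response : IsClosed (LinearMap.range B.response : Set (Fin K → ℝ)) :=
  Submodule.closed_of_finiteDimensional _

theorem isClosed_slice (x : B.Scenario) : IsClosed (B.slice x) := by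
  have : B.slice x = (LinearMap.range B.response : Set (Fin K → ℝ)) ∩
      {y | y B.best - y x = B.gap x} := by
    ext y; exact B.mem_slice_iff
  rw [this]
  exact B.isClosed_range_response.inter (isClosed_eq (by fun_prop) continuous_const)

theorem add_smul_mem_slice {x : B.Scenario} {y z : Fin K → ℝ} (hy : y ∈ B.slice x)
    (hz : z ∈ LinearMap.range B.response) (hz0 : z B.best - z x = 0) (t : ℝ) :
    y + t • z ∈ B.slice x := by
  rw [mem_slice_iff] at hy ⊢
  refine ⟨add_mem hy.1 (Submodule.smul_mem _ _ hz), ?_⟩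
  simp only [Pi.add_apply, Pi.smul_apply, smul_eq_mul]
  linear_combination hy.2 + t * hz0

/-- The first-order optimality condition. -/
theorem IsMinimizer.cross_eq_zero {p : Fin K → ℝ} (hp : p ∈ orthant K) {x : B.Scenario}
    {y z : Fin K → ℝ} (hy : B.IsMinimizer p x y) (hz : z ∈ LinearMap.range B.response)
    (hz0 : z B.best - z x = 0) : B.cross p y z = 0 := by
  have key : ∀ t : ℝ, 0 ≤ 2 * t * B.cross p y z + t ^ 2 * B.energy p z := by
    intro t
    have := hy.2 _ (B.add_smul_mem_slice hy.1 hz hz0 t)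
    rw [energy_add_smul] at this
    linarith
  have he := B.energy_nonneg hp z
  by_contra hb
  -- A small multiple of minus the cross term makes the quadratic negative; the `+ 1` covers a
  -- vanishing energy of `z`.
  have h := key (-(B.cross p y z) / (B.energy p z + 1))
  have hpos : 0 < B.cross p y z ^ 2 / (B.energy p z + 1) ^ 2 := by positivity
  have : 2 * (-(B.cross p y z) / (B.energy p z + 1)) * B.cross p y z +
      (-(B.cross p y z) / (B.energy p z + 1)) ^ 2 * B.energy p z =
      -(B.cross p y z ^ 2 / (B.energy p z + 1) ^ 2) * (B.energy p z + 2) := by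
    field_simp
    ring
  rw [this] at h
  nlinarith

theorem IsMinimizer.cross_sub_eq_zero {p : Fin K → ℝ} (hp : p ∈ orthant K) {x : B.Scenario}
    {y y' : Fin K → ℝ} (hy : B.IsMinimizer p x y) (hy' : y' ∈ B.slice x) :
    B.cross p y (y' - y) = 0 := by
  have h1 := B.mem_slice_iff.1 hy.1
  have h2 := B.mem_slice_iff.1 hy'
  refine IsMinimizer.cross_eq_zero B hp hy (sub_mem h2.1 h1.1) ?_
  simp only [Pi.sub_apply]
  linarith [h1.2, h2.2]

theorem sq_le_of_energy_le {p y : Fin K → ℝ} (hp : ∀ i, 0 < p i) {e : ℝ}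
    (h : B.energy p y ≤ e) (i : Fin K) : y i ^ 2 ≤ e / p i * (2 * (B.σ i : ℝ) ^ 2) := by
  have hσ := B.σ_pos' i
  have h1 : p i * B.rate y i ≤ e :=
    (Finset.single_le_sum (f := fun i => p i * B.rate y i)
      (fun j _ => mul_nonneg (hp j).le (B.rate_nonneg y j)) (Finset.mem_univ i)).trans h
  have h2 : B.rate y i ≤ e / p i := by rw [le_div_iff₀ (hp i)]; linarith
  rwa [rate, div_le_iff₀ (by positivity)] at h2

theorem exists_isMinimizer_of_pos {p : Fin K → ℝ} (hp : ∀ i, 0 < p i) (x : B.Scenario) :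
    ∃ y, B.IsMinimizer p x y := by
  obtain ⟨y₀, hy₀⟩ := B.slice_nonempty x
  set s : Set (Fin K → ℝ) := B.slice x ∩ {y | B.energy p y ≤ B.energy p y₀} with hs
  have hcont : Continuous (B.energy p) := B.continuous_energy.comp (by fun_prop : Continuous
    fun y : Fin K → ℝ => (p, y))
  have hclosed : IsClosed s := (B.isClosed_slice x).inter (isClosed_le hcont continuous_const)
  have hbdd : Bornology.IsBounded s := by
    refine Bornology.IsBounded.subset (t := Set.pi univ fun i => Icc
      (-√(B.energy p y₀ / p i * (2 * (B.σ i : ℝ) ^ 2)))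
      (√(B.energy p y₀ / p i * (2 * (B.σ i : ℝ) ^ 2)))) ?_ ?_
    · exact Bornology.IsBounded.pi fun i => Metric.isBounded_Icc _ _
    · intro y hy i _
      exact abs_le.1 (Real.abs_le_sqrt (B.sq_le_of_energy_le hp hy.2 i))
  obtain ⟨y, hy, hmin⟩ := (Metric.isCompact_of_isClosed_isBounded hclosed hbdd).exists_isMinOn
    ⟨y₀, hy₀, le_refl (B.energy p y₀)⟩ hcont.continuousOn
  refine ⟨y, hy.1, fun y' hy' => ?_⟩
  by_cases h : B.energy p y' ≤ B.energy p y₀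
  · exact hmin ⟨hy', h⟩
  · exact hy.2.trans (not_le.1 h).le

/-! ### Bounded minimizers, uniformly up to the boundary of the orthant -/

/-- The minimizers are bounded uniformly in the weights. -/
theorem exists_bound_isMinimizer_of_pos (x : B.Scenario) :
    ∃ R : ℝ, ∀ p : Fin K → ℝ, (∀ i, 0 < p i) → ∀ y, B.IsMinimizer p x y → ‖y‖ ≤ R := by
  -- Unbounded minimizers, after normalization, would accumulate at a unit shift `z` of zero gap, an
  -- admissible direction for the first-order condition.
  by_contra hcon
  push Not at hcon
  choose p hp y hy hyn using fun n : ℕ => hcon (n + 1)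
  have hpos : ∀ n, 0 < ‖y n‖ := fun n => lt_trans (by positivity) (hyn n)
  have hmem : ∀ n, (‖y n‖)⁻¹ • y n ∈ Metric.sphere (0 : Fin K → ℝ) 1 := by
    intro n
    rw [mem_sphere_zero_iff_norm, norm_smul, norm_inv, norm_norm, inv_mul_cancel₀ (hpos n).ne']
  obtain ⟨z, hz, φ, hφ, hlim⟩ := (isCompact_sphere (0 : Fin K → ℝ) 1).tendsto_subseq hmem
  have hnorm : Tendsto (fun n => ‖y n‖) atTop atTop :=
    tendsto_atTop_mono (fun n => (hyn n).le)
      (tendsto_atTop_add_const_right _ _ tendsto_natCast_atTop_atTop)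
  have hzrange : z ∈ LinearMap.range B.response := by
    refine B.isClosed_range_response.mem_of_tendsto hlim (Eventually.of_forall fun n => ?_)
    exact Submodule.smul_mem _ _ (B.mem_slice_iff.1 (hy (φ n)).1).1
  have hcoord : ∀ i, Tendsto (fun n => (‖y (φ n)‖)⁻¹ * y (φ n) i) atTop (𝓝 (z i)) := by
    intro i
    exact (tendsto_pi_nhds.1 hlim i)
  have hz0 : z B.best - z x = 0 := by
    have h1 := (hcoord B.best).sub (hcoord x)
    have h2 : Tendsto (fun n => (‖y (φ n)‖)⁻¹ * B.gap x) atTop (𝓝 (0 * B.gap x)) :=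
      (tendsto_inv_atTop_zero.comp (hnorm.comp hφ.tendsto_atTop)).mul_const _
    rw [zero_mul] at h2
    refine tendsto_nhds_unique (h1.congr fun n => ?_) h2
    rw [← (B.mem_slice_iff.1 (hy (φ n)).1).2]
    ring
  -- Eventually `y` and `z` agree in sign wherever `z ≠ 0`. The cross term is then positive whatever
  -- the positive weights are, so no lower bound on the weights is needed.
  have hev : ∀ᶠ n in atTop, ∀ i, z i ≠ 0 → 0 < y (φ n) i * z i := by
    rw [eventually_all]
    intro i
    by_cases hzi : z i = 0
    · exact Eventually.of_forall fun n h => absurd hzi h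
    · have h1 := (hcoord i).mul_const (z i)
      have h2 : 0 < z i * z i := mul_self_pos.2 hzi
      filter_upwards [h1.eventually (lt_mem_nhds h2)] with n hn _
      have h3 : 0 < (‖y (φ n)‖)⁻¹ := inv_pos.2 (hpos _)
      rw [mul_assoc] at hn
      exact (mul_pos_iff_of_pos_left h3).1 hn
  obtain ⟨n, hn⟩ := hev.exists
  have hcross := IsMinimizer.cross_eq_zero B (fun i => (hp (φ n) i).le) (hy (φ n)) hzrange hz0
  obtain ⟨i, hi⟩ : ∃ i, z i ≠ 0 := by
    by_contra h
    push Not at h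
    have : z = 0 := funext h
    simp [this] at hz
  have hσ := fun i => B.σ_pos' i
  have : 0 < B.cross (p (φ n)) (y (φ n)) z := by
    refine Finset.sum_pos' (fun j _ => ?_) ⟨i, Finset.mem_univ _, ?_⟩
    · have := hp (φ n) j
      have := hσ j
      by_cases hj : z j = 0
      · simp [hj]
      · have := hn j hj
        positivity
    · have := hp (φ n) i
      have := hσ i
      have := hn i hi
      positivity
  exact this.ne' hcross

theorem exists_bound_isMinimizer :
    ∃ R : ℝ, ∀ x : B.Scenario, ∀ p : Fin K → ℝ, (∀ i, 0 < p i) →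
      ∀ y, B.IsMinimizer p x y → ‖y‖ ≤ R := by
  choose R hR using B.exists_bound_isMinimizer_of_pos
  refine ⟨∑ x, |R x|, fun x p hp y hy => (hR x p hp y hy).trans ((le_abs_self _).trans ?_)⟩
  exact Finset.single_le_sum (f := fun x => |R x|) (fun _ _ => abs_nonneg _) (Finset.mem_univ x)

/-- A bound for the minimizers at positive weights. -/
def radius : ℝ := Classical.choose B.exists_bound_isMinimizer

/-- A minimizer whose norm is at most `radius`. -/
def IsBoundedMinimizer (p : Fin K → ℝ) (x : B.Scenario) (y : Fin K → ℝ) : Prop :=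
  B.IsMinimizer p x y ∧ ‖y‖ ≤ B.radius

theorem isBoundedMinimizer_of_pos {p : Fin K → ℝ} (hp : ∀ i, 0 < p i) {x : B.Scenario}
    {y : Fin K → ℝ} (hy : B.IsMinimizer p x y) : B.IsBoundedMinimizer p x y :=
  ⟨hy, Classical.choose_spec B.exists_bound_isMinimizer x p hp y hy⟩

/-- The slice is closed and the energy jointly continuous, so minimality survives even if some
weights tend to zero. -/
theorem isBoundedMinimizer_of_tendsto {p : ℕ → Fin K → ℝ} {y : ℕ → Fin K → ℝ}
    {p₀ y₀ : Fin K → ℝ} {x : B.Scenario} (hy : ∀ n, B.IsBoundedMinimizer (p n) x (y n))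
    (hp₀ : Tendsto p atTop (𝓝 p₀)) (hy₀ : Tendsto y atTop (𝓝 y₀)) :
    B.IsBoundedMinimizer p₀ x y₀ := by
  refine ⟨⟨(B.isClosed_slice x).mem_of_tendsto hy₀ (Eventually.of_forall fun n => (hy n).1.1),
    fun z hz => ?_⟩, le_of_tendsto hy₀.norm (Eventually.of_forall fun n => (hy n).2)⟩
  have h1 : Tendsto (fun n => B.energy (p n) (y n)) atTop (𝓝 (B.energy p₀ y₀)) :=
    (B.continuous_energy.tendsto (p₀, y₀)).comp (hp₀.prodMk_nhds hy₀)
  have h2 : Tendsto (fun n => B.energy (p n) z) atTop (𝓝 (B.energy p₀ z)) :=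
    (B.continuous_energy.tendsto (p₀, z)).comp (hp₀.prodMk_nhds tendsto_const_nhds)
  exact le_of_tendsto_of_tendsto' h1 h2 fun n => (hy n).1.2 _ hz

/-- A family of bounded minimizers has a convergent subsequence. -/
theorem exists_subseq_tendsto {ι : Type*} [Finite ι] {y : ℕ → ι → Fin K → ℝ}
    (hy : ∀ n x, ‖y n x‖ ≤ B.radius) :
    ∃ y₀ : ι → Fin K → ℝ, ∃ φ : ℕ → ℕ, StrictMono φ ∧
      ∀ x, Tendsto (fun n => y (φ n) x) atTop (𝓝 (y₀ x)) := by
  have hc : IsCompact (Set.pi univ fun _ : ι => Metric.closedBall (0 : Fin K → ℝ) B.radius) :=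
    isCompact_univ_pi fun _ => isCompact_closedBall _ _
  obtain ⟨y₀, -, φ, hφ, hlim⟩ := hc.tendsto_subseq
    (x := y) (fun n x _ => mem_closedBall_zero_iff.2 (hy n x))
  exact ⟨y₀, φ, hφ, fun x => tendsto_pi_nhds.1 hlim x⟩

/-- At zero weights the sublevel sets may be unbounded, so minimizers are obtained by making all
weights positive and passing to the limit. -/
theorem exists_isBoundedMinimizer {p : Fin K → ℝ} (hp : p ∈ orthant K) (x : B.Scenario) :
    ∃ y, B.IsBoundedMinimizer p x y := by
  set q : ℕ → Fin K → ℝ := fun n i => p i + 1 / ((n : ℝ) + 1) with hq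
  have hqpos : ∀ n i, 0 < q n i := fun n i => add_pos_of_nonneg_of_pos (hp i) (by positivity)
  have hqlim : Tendsto q atTop (𝓝 p) := by
    rw [tendsto_pi_nhds]
    intro i
    simpa [hq] using tendsto_one_div_add_atTop_nhds_zero_nat.const_add (p i)
  choose y hy using fun n => B.exists_isMinimizer_of_pos (hqpos n) x
  have hb := fun n => B.isBoundedMinimizer_of_pos (hqpos n) (hy n)
  obtain ⟨y₀, φ, hφ, hlim⟩ := B.exists_subseq_tendsto (ι := Unit) (y := fun n _ => y n)
    fun n _ => (hb n).2
  exact ⟨y₀ (), B.isBoundedMinimizer_of_tendsto (fun n => hb (φ n))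
    (hqlim.comp hφ.tendsto_atTop) (hlim ())⟩

/-- A choice of a bounded minimizer. -/
def minimizer (p : Fin K → ℝ) (x : B.Scenario) : Fin K → ℝ :=
  Classical.epsilon fun y => B.IsBoundedMinimizer p x y

theorem minimizer_spec {p : Fin K → ℝ} (hp : p ∈ orthant K) (x : B.Scenario) :
    B.IsBoundedMinimizer p x (B.minimizer p x) :=
  Classical.epsilon_spec (B.exists_isBoundedMinimizer hp x)

theorem D_eq {p : Fin K → ℝ} (hp : p ∈ orthant K) (x : B.Scenario) :
    B.D p x = B.energy p (B.minimizer p x) :=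
  B.D_eq_energy hp (B.minimizer_spec hp x).1

theorem D_le_energy {p : Fin K → ℝ} (hp : p ∈ orthant K) {x : B.Scenario} {y : Fin K → ℝ}
    (hy : y ∈ B.slice x) : B.D p x ≤ B.energy p y := by
  rw [B.D_eq hp]; exact (B.minimizer_spec hp x).1.2 y hy

theorem D_nonneg {p : Fin K → ℝ} (hp : p ∈ orthant K) (x : B.Scenario) : 0 ≤ B.D p x := by
  rw [B.D_eq hp]; exact B.energy_nonneg hp _


/-! ### Active span, coercivity and stability of minimizers -/

theorem energy_sub_energy (p q y : Fin K → ℝ) :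
    B.energy p y - B.energy q y = ∑ i, (p i - q i) * B.rate y i := by
  simp only [energy, ← Finset.sum_sub_distrib, sub_mul]

theorem energy_eq_zero_iff {p : Fin K → ℝ} (hp : p ∈ orthant K) {y : Fin K → ℝ} :
    B.energy p y = 0 ↔ ∀ i, 0 < p i → y i = 0 := by
  rw [energy, Finset.sum_eq_zero_iff_of_nonneg
    fun i _ => mul_nonneg (hp i) (B.rate_nonneg y i)]
  refine ⟨fun h i hi => ?_, fun h i _ => ?_⟩
  · have h1 := (mul_eq_zero.1 (h i (Finset.mem_univ i))).resolve_left hi.ne'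
    have hσ := B.σ_pos' i
    simpa [rate, hσ.ne'] using h1
  · rcases (hp i).eq_or_lt with h0 | h0
    · rw [← h0, zero_mul]
    · simp [rate, h i h0]

theorem inner_eq_zero_of_mem_activeSpan {p : Fin K → ℝ} {h v : EuclideanSpace ℝ (Fin d)}
    (hh : ∀ i, 0 < p i → B.response h i = 0) (hv : v ∈ B.activeSpan p) : inner ℝ v h = 0 := by
  have : B.activeSpan p ≤ (Submodule.span ℝ {h})ᗮ := by
    refine Submodule.span_le.2 ?_
    rintro _ ⟨i, hi, rfl⟩
    rw [SetLike.mem_coe, Submodule.mem_orthogonal_singleton_iff_inner_left]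
    exact hh i hi
  exact Submodule.mem_orthogonal_singleton_iff_inner_left.1 (this hv)

theorem a_mem_fullSpan (i : Fin K) : B.a i ∈ B.fullSpan := Submodule.subset_span ⟨i, rfl⟩

theorem a_mem_activeSpan {p : Fin K → ℝ} {i : Fin K} (hi : 0 < p i) : B.a i ∈ B.activeSpan p :=
  Submodule.subset_span ⟨i, hi, rfl⟩

theorem activeSpan_le_fullSpan (p : Fin K → ℝ) : B.activeSpan p ≤ B.fullSpan :=
  Submodule.span_mono (image_subset_range _ _)

theorem activeSpan_mono {p q : Fin K → ℝ} (h : ∀ i, 0 < p i → 0 < q i) :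
    B.activeSpan p ≤ B.activeSpan q :=
  Submodule.span_mono (image_mono fun i hi => h i hi)

theorem activeSpan_of_pos {p : Fin K → ℝ} (hp : ∀ i, 0 < p i) : B.activeSpan p = B.fullSpan := by
  refine le_antisymm (B.activeSpan_le_fullSpan p) (Submodule.span_le.2 ?_)
  rintro _ ⟨i, rfl⟩
  exact B.a_mem_activeSpan (hp i)

/-- With active arms of full span, the energy is coercive on the mean shifts. -/
theorem exists_coercive {p : Fin K → ℝ} (hp : p ∈ orthant K)
    (hS : B.activeSpan p = B.fullSpan) :
    ∃ c > 0, ∀ z ∈ LinearMap.range B.response, c * ‖z‖ ^ 2 ≤ B.energy p z := by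
  set s : Set (Fin K → ℝ) := (LinearMap.range B.response : Set (Fin K → ℝ)) ∩
    Metric.sphere 0 1 with hs
  have hcont : Continuous (B.energy p) := B.continuous_energy.comp (by fun_prop : Continuous
    fun y : Fin K → ℝ => (p, y))
  have hcpt : IsCompact s := (isCompact_sphere _ _).inter_left B.isClosed_range_response
  have hpos : ∀ z ∈ s, 0 < B.energy p z := by
    rintro z ⟨⟨h, rfl⟩, hz⟩
    refine (B.energy_nonneg hp _).lt_of_ne' fun h0 => ?_
    rw [B.energy_eq_zero_iff hp] at h0
    -- Shifts vanishing on the active arms vanish on their span, which contains every feature.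
    have : B.response h = 0 := by
      ext i
      exact B.inner_eq_zero_of_mem_activeSpan h0 (hS ▸ B.a_mem_fullSpan i)
    simp [this] at hz
  obtain ⟨c, hc, hmin⟩ := hcpt.exists_forall_le' hcont.continuousOn hpos
  refine ⟨c, hc, fun z hz => ?_⟩
  by_cases hz0 : z = 0
  · simp [hz0, energy, rate]
  have hn : 0 < ‖z‖ := norm_pos_iff.2 hz0
  have h1 := hmin ((‖z‖)⁻¹ • z) ⟨Submodule.smul_mem _ _ hz, by
    rw [mem_sphere_zero_iff_norm, norm_smul, norm_inv, norm_norm, inv_mul_cancel₀ hn.ne']⟩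
  rw [energy_smul, inv_pow, inv_mul_eq_div, le_div_iff₀ (by positivity)] at h1
  exact h1

theorem radius_nonneg (x : B.Scenario) : 0 ≤ B.radius :=
  (norm_nonneg _).trans (B.minimizer_spec (p := 0) (fun _ => le_rfl) x).2

/-- The sum of the precisions of the arms, times the radius. -/
def lipConst : ℝ := ∑ i, B.radius / (2 * (B.σ i : ℝ) ^ 2)

theorem lipConst_nonneg (x : B.Scenario) : 0 ≤ B.lipConst :=
  Finset.sum_nonneg fun _ _ => div_nonneg (B.radius_nonneg x) (by positivity)

/-- Minimizers depend in a Lipschitz way on the weights, as long as the energy is coercive. -/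
theorem norm_sub_le_of_isBoundedMinimizer {p q : Fin K → ℝ} (hp : p ∈ orthant K)
    (hq : q ∈ orthant K) {c : ℝ}
    (hc : ∀ z ∈ LinearMap.range B.response, c * ‖z‖ ^ 2 ≤ B.energy p z)
    {x : B.Scenario} {y y' : Fin K → ℝ} (hy : B.IsBoundedMinimizer p x y)
    (hy' : B.IsBoundedMinimizer q x y') : c * ‖y' - y‖ ≤ B.lipConst * ‖q - p‖ := by
  have h1 := IsMinimizer.cross_sub_eq_zero B hp hy.1 hy'.1.1
  have h2 := IsMinimizer.cross_sub_eq_zero B hq hy'.1 hy.1.1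
  have h3 : B.energy p (y' - y) =
      ∑ i, (p i - q i) * (y' i * (y' i - y i) / (2 * (B.σ i : ℝ) ^ 2)) := by
    -- Adding both first-order conditions cancels everything except terms carrying a factor `p i - q
    -- i`.
    have : B.energy p (y' - y) = B.energy p (y' - y) + B.cross p y (y' - y) +
      B.cross q y' (y - y') := by rw [h1, h2]; ring
    rw [this]
    simp only [energy, cross, rate, ← Finset.sum_add_distrib, Pi.sub_apply]
    refine Finset.sum_congr rfl fun i _ => ?_
    ring
  have h4 : B.energy p (y' - y) ≤ B.lipConst * ‖q - p‖ * ‖y' - y‖ := by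
    rw [h3, lipConst, Finset.sum_mul, Finset.sum_mul]
    refine Finset.sum_le_sum fun i _ => ?_
    have hσ := B.σ_pos' i
    have e1 : |p i - q i| ≤ ‖q - p‖ := by
      rw [abs_sub_comm]; exact norm_le_pi_norm (q - p) i
    have e2 : |y' i| ≤ B.radius := (norm_le_pi_norm y' i).trans hy'.2
    have e3 : |y' i - y i| ≤ ‖y' - y‖ := norm_le_pi_norm (y' - y) i
    calc (p i - q i) * (y' i * (y' i - y i) / (2 * (B.σ i : ℝ) ^ 2))
        ≤ |(p i - q i) * (y' i * (y' i - y i) / (2 * (B.σ i : ℝ) ^ 2))| := le_abs_self _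
      _ = |p i - q i| * (|y' i| * |y' i - y i| / (2 * (B.σ i : ℝ) ^ 2)) := by
          rw [abs_mul, abs_div, abs_mul, abs_of_pos (by positivity : (0:ℝ) < 2 * (B.σ i : ℝ) ^ 2)]
      _ ≤ ‖q - p‖ * (B.radius * ‖y' - y‖ / (2 * (B.σ i : ℝ) ^ 2)) := by
          have := B.radius_nonneg x
          gcongr
      _ = _ := by ring
  have h5 := hc (y' - y) (sub_mem (B.mem_slice_iff.1 hy'.1.1).1 (B.mem_slice_iff.1 hy.1.1).1)
  rcases (norm_nonneg (y' - y)).eq_or_lt with h0 | h0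
  · rw [← h0, mul_zero]
    exact mul_nonneg (B.lipConst_nonneg x) (norm_nonneg _)
  · refine le_of_mul_le_mul_right ?_ h0
    linarith [h5.trans h4, (by ring : c * ‖y' - y‖ * ‖y' - y‖ = c * ‖y' - y‖ ^ 2)]

theorem IsBoundedMinimizer.unique {p : Fin K → ℝ} (hp : p ∈ orthant K)
    (hS : B.activeSpan p = B.fullSpan) {x : B.Scenario} {y y' : Fin K → ℝ}
    (hy : B.IsBoundedMinimizer p x y) (hy' : B.IsBoundedMinimizer p x y') : y' = y := by
  obtain ⟨c, hc, h⟩ := B.exists_coercive hp hS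
  have h1 := B.norm_sub_le_of_isBoundedMinimizer hp hp h hy hy'
  rw [sub_self, norm_zero, mul_zero] at h1
  have : ‖y' - y‖ ≤ 0 := by
    by_contra hn
    push Not at hn
    nlinarith
  exact sub_eq_zero.1 (norm_le_zero_iff.1 this)

theorem abs_rate_sub_le {y y' : Fin K → ℝ} (hy : ‖y‖ ≤ B.radius) (hy' : ‖y'‖ ≤ B.radius)
    (i : Fin K) :
    |B.rate y' i - B.rate y i| ≤ 2 * (B.radius / (2 * (B.σ i : ℝ) ^ 2)) * ‖y' - y‖ := by
  have hσ := B.σ_pos' i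
  have e1 : |y i| ≤ B.radius := (norm_le_pi_norm y i).trans hy
  have e2 : |y' i| ≤ B.radius := (norm_le_pi_norm y' i).trans hy'
  have e3 : |y' i - y i| ≤ ‖y' - y‖ := norm_le_pi_norm (y' - y) i
  have e4 : |y' i + y i| ≤ 2 * B.radius := (abs_add_le _ _).trans (by linarith)
  have : B.rate y' i - B.rate y i = (y' i + y i) * (y' i - y i) / (2 * (B.σ i : ℝ) ^ 2) := by
    simp only [rate]; ring
  rw [this, abs_div, abs_mul, abs_of_pos (by positivity : (0:ℝ) < 2 * (B.σ i : ℝ) ^ 2)]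
  calc |y' i + y i| * |y' i - y i| / (2 * (B.σ i : ℝ) ^ 2)
      ≤ (2 * B.radius) * ‖y' - y‖ / (2 * (B.σ i : ℝ) ^ 2) := by
        have := (abs_nonneg _).trans e4
        gcongr
    _ = _ := by ring

theorem abs_sum_sub_mul_rate_sub_le {p q y y' : Fin K → ℝ} (hy : ‖y‖ ≤ B.radius)
    (hy' : ‖y'‖ ≤ B.radius) :
    |∑ i, (q i - p i) * (B.rate y' i - B.rate y i)| ≤
      2 * B.lipConst * ‖q - p‖ * ‖y' - y‖ := by
  rw [lipConst, Finset.mul_sum, Finset.sum_mul, Finset.sum_mul]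
  refine (Finset.abs_sum_le_sum_abs _ _).trans (Finset.sum_le_sum fun i _ => ?_)
  rw [abs_mul]
  have e1 : |q i - p i| ≤ ‖q - p‖ := norm_le_pi_norm (q - p) i
  calc |q i - p i| * |B.rate y' i - B.rate y i|
      ≤ ‖q - p‖ * (2 * (B.radius / (2 * (B.σ i : ℝ) ^ 2)) * ‖y' - y‖) := by
        gcongr
        exact B.abs_rate_sub_le hy hy' i
    _ = _ := by ring

/-! ### Danskin's formula and zero-information scenarios -/

/-- The linear functional with coefficients `f`. -/
def coeffCLM (f : Fin K → ℝ) : (Fin K → ℝ) →L[ℝ] ℝ :=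
  ∑ i, f i • ContinuousLinearMap.proj (R := ℝ) (φ := fun _ : Fin K => ℝ) i

theorem coeffCLM_apply (f q : Fin K → ℝ) : coeffCLM f q = ∑ i, q i * f i := by
  simp [coeffCLM, mul_comm]

theorem coeffCLM_single (f : Fin K → ℝ) (i : Fin K) : coeffCLM f (Pi.single i 1) = f i := by
  simp [coeffCLM_apply, Pi.single_apply]

theorem coeffCLM_rate (y q : Fin K → ℝ) : coeffCLM (B.rate y) q = B.energy q y :=
  coeffCLM_apply _ _

theorem uniqueDiffOn_orthant : UniqueDiffOn ℝ (orthant K) := by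
  have : orthant K = Set.pi univ fun _ => Ici (0 : ℝ) := by
    ext p
    simp only [orthant, mem_ofPred_eq, Set.mem_pi, mem_univ, true_imp_iff, mem_Ici]
  rw [this]
  exact UniqueDiffOn.univ_pi fun _ => uniqueDiffOn_Ici 0

/-- Danskin's formula at weights whose active arms have full span. -/
theorem hasFDerivWithinAt_D {p : Fin K → ℝ} (hp : p ∈ orthant K)
    (hS : B.activeSpan p = B.fullSpan) {x : B.Scenario} {y : Fin K → ℝ}
    (hy : B.IsBoundedMinimizer p x y) :
    HasFDerivWithinAt (fun q => B.D q x) (coeffCLM (B.rate y)) (orthant K) p := by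
  obtain ⟨c, hc, hcoer⟩ := B.exists_coercive hp hS
  have hL := B.lipConst_nonneg x
  -- Testing `q` with `y` bounds the remainder above by zero; testing `p` with `y'` bounds it below
  -- by the pairing of `q - p` with the change of rates. Both factors are of order `‖q - p‖`, so the
  -- remainder is quadratic.
  have hO : (fun q => B.D q x - coeffCLM (B.rate y) q) =O[𝓝[orthant K] p]
      fun q => ‖q - p‖ ^ 2 := by
    refine Asymptotics.IsBigO.of_bound (2 * B.lipConst * (B.lipConst / c)) ?_
    filter_upwards [self_mem_nhdsWithin] with q hq
    rw [coeffCLM_rate]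
    set y' := B.minimizer q x
    have hy' : B.IsBoundedMinimizer q x y' := B.minimizer_spec hq x
    have h1 : B.D q x - B.energy q y ≤ 0 := sub_nonpos.2 (B.D_le_energy hq hy.1.1)
    have h2 : ∑ i, (q i - p i) * (B.rate y' i - B.rate y i) ≤ B.D q x - B.energy q y := by
      have e1 := B.energy_sub_energy q p y'
      have e2 := B.energy_sub_energy q p y
      have e3 := hy.1.2 y' hy'.1.1
      rw [B.D_eq hq]
      simp only [mul_sub, Finset.sum_sub_distrib]
      change _ ≤ B.energy q y' - _
      linarith
    have h3 := B.abs_sum_sub_mul_rate_sub_le (p := p) (q := q) hy.2 hy'.2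
    have h4 := B.norm_sub_le_of_isBoundedMinimizer hp hq hcoer hy hy'
    have h5 : ‖y' - y‖ ≤ B.lipConst / c * ‖q - p‖ := by
      rw [div_mul_eq_mul_div, le_div_iff₀ hc]; linarith
    rw [Real.norm_of_nonpos h1, Real.norm_of_nonneg (by positivity)]
    calc -(B.D q x - B.energy q y)
        ≤ 2 * B.lipConst * ‖q - p‖ * ‖y' - y‖ := by
          linarith [neg_abs_le (∑ i, (q i - p i) * (B.rate y' i - B.rate y i))]
      _ ≤ 2 * B.lipConst * ‖q - p‖ * (B.lipConst / c * ‖q - p‖) := by gcongr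
      _ = _ := by ring
  have h := (hO.hasFDerivWithinAt hp (by norm_num)).add
    (coeffCLM (B.rate y)).hasFDerivWithinAt
  rw [zero_add] at h
  have hfun : (fun q => B.D q x) =
      (fun q => B.D q x - coeffCLM (B.rate y) q) + ⇑(coeffCLM (B.rate y)) := by
    ext q; simp
  rw [hfun]
  exact h

/-- Zero information means that some shift closing the gap is invisible to all active arms. It
exists when `δ_x` has a nonzero component orthogonal to the active span, and that component,
rescaled, is such a shift. -/
theorem D_eq_zero_iff {p : Fin K → ℝ} (hp : p ∈ orthant K) (x : B.Scenario) :
    B.D p x = 0 ↔ B.delta x ∉ B.activeSpan p := by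
  constructor
  · intro h0 hmem
    rw [B.D_eq hp, B.energy_eq_zero_iff hp] at h0
    obtain ⟨h, hh, hg⟩ := (B.minimizer_spec hp x).1.1
    rw [← hh] at h0
    have := B.inner_eq_zero_of_mem_activeSpan h0 hmem
    exact (B.gap_pos x).ne' (hg ▸ this)
  · intro hmem
    set S := B.activeSpan p
    set u := Sᗮ.starProjection (B.delta x) with hu
    have huS : u ∈ Sᗮ := Submodule.starProjection_apply_mem _ _
    have hu0 : u ≠ 0 := by
      intro h
      rw [hu, Submodule.starProjection_apply_eq_zero_iff, Submodule.orthogonal_orthogonal] at h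
      exact hmem h
    have hin : inner ℝ (B.delta x) u = ‖u‖ ^ 2 := by
      have : inner ℝ (B.delta x - u) u = 0 := by
        rw [hu]
        exact Submodule.starProjection_inner_eq_zero _ _ huS
      rw [inner_sub_left, real_inner_self_eq_norm_sq] at this
      linarith
    have hpos : 0 < ‖u‖ ^ 2 := by positivity
    have hmem' : B.response ((B.gap x / ‖u‖ ^ 2) • u) ∈ B.slice x :=
      ⟨_, rfl, by rw [inner_smul_right, hin, div_mul_cancel₀ _ hpos.ne']⟩
    refine le_antisymm ((B.D_le_energy hp hmem').trans_eq ?_) (B.D_nonneg hp x)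
    rw [B.energy_eq_zero_iff hp]
    intro i hi
    rw [response_apply, inner_smul_right,
      (Submodule.mem_orthogonal S u).1 huS _ (B.a_mem_activeSpan hi), mul_zero]

theorem exists_pos_of_mem_stdSimplex {p : Fin K → ℝ} (hp : p ∈ stdSimplex ℝ (Fin K)) :
    ∃ i, 0 < p i := by
  by_contra h
  push Not at h
  have := Finset.sum_nonpos fun i (_ : i ∈ Finset.univ) => h i
  rw [hp.2] at this
  linarith

theorem a_mem_of_delta_mem {S : Submodule ℝ (EuclideanSpace ℝ (Fin d))} {i : Fin K}
    (hi : B.a i ∈ S) (h : ∀ x, B.delta x ∈ S) (j : Fin K) : B.a j ∈ S := by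
  have hb : B.a B.best ∈ S := by
    by_cases hib : i = B.best
    · exact hib ▸ hi
    · have := add_mem (h ⟨i, hib⟩) hi
      simpa [delta] using this
  by_cases hj : j = B.best
  · exact hj ▸ hb
  · have := sub_mem hb (h ⟨j, hj⟩)
    simpa [delta] using this

/-- A point of the simplex has an active arm; from it and all the `δ_x` every feature is recovered.
-/
theorem zeroInfo_eq_empty_iff {p : Fin K → ℝ} (hp : p ∈ stdSimplex ℝ (Fin K)) :
    B.zeroInfo p = ∅ ↔ B.activeSpan p = B.fullSpan := by
  have h1 : B.zeroInfo p = ∅ ↔ ∀ x, B.delta x ∈ B.activeSpan p := by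
    rw [eq_empty_iff_forall_notMem]
    refine forall_congr' fun x => ?_
    rw [zeroInfo, mem_ofPred_eq, B.D_eq_zero_iff hp.1, not_not]
  rw [h1]
  constructor
  · intro h
    obtain ⟨i, hi⟩ := exists_pos_of_mem_stdSimplex hp
    refine le_antisymm (B.activeSpan_le_fullSpan p) (Submodule.span_le.2 ?_)
    rintro _ ⟨j, rfl⟩
    exact B.a_mem_of_delta_mem (B.a_mem_activeSpan hi) h j
  · intro h x
    rw [h]
    exact sub_mem (B.a_mem_fullSpan _) (B.a_mem_fullSpan _)

theorem D_pos_of_activeSpan_eq {p : Fin K → ℝ} (hp : p ∈ orthant K)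
    (hS : B.activeSpan p = B.fullSpan) (x : B.Scenario) : 0 < B.D p x := by
  refine (B.D_nonneg hp x).lt_of_ne' fun h => ?_
  rw [B.D_eq_zero_iff hp, hS] at h
  exact h (sub_mem (B.a_mem_fullSpan _) (B.a_mem_fullSpan _))


theorem mem_diffSet_of_activeSpan_eq {p : Fin K → ℝ} {μ : B.Scenario → ℝ}
    (hp : p ∈ stdSimplex ℝ (Fin K)) (hμ : μ ∈ stdSimplex ℝ B.Scenario)
    (hS : B.activeSpan p = B.fullSpan) : (p, μ) ∈ B.diffSet := by
  refine ⟨hp, hμ, ?_⟩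
  refine DifferentiableWithinAt.fun_sum fun x _ => ?_
  have h1 : DifferentiableWithinAt ℝ (fun w : (Fin K → ℝ) × (B.Scenario → ℝ) => B.D w.1 x)
      (orthant K ×ˢ univ) (p, μ) := by
    have := (B.hasFDerivWithinAt_D hp.1 hS (B.minimizer_spec hp.1 x)).differentiableWithinAt
    exact DifferentiableWithinAt.comp (g := fun q => B.D q x) (p, μ) this
      differentiableWithinAt_fst fun w hw => hw.1
  have h2 : DifferentiableWithinAt ℝ (fun w : (Fin K → ℝ) × (B.Scenario → ℝ) => w.2 x)
      (orthant K ×ˢ univ) (p, μ) :=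
    ((ContinuousLinearMap.proj (R := ℝ) (φ := fun _ : B.Scenario => ℝ) x).comp
      (ContinuousLinearMap.snd ℝ (Fin K → ℝ) (B.Scenario → ℝ))).differentiableAt
        |>.differentiableWithinAt
  exact h2.mul h1

theorem differentiableWithinAt_F_of_mem_diffSet {p : Fin K → ℝ} {μ : B.Scenario → ℝ}
    (h : (p, μ) ∈ B.diffSet) : DifferentiableWithinAt ℝ (fun q => B.F q μ) (orthant K) p :=
  DifferentiableWithinAt.comp (g := fun w : (Fin K → ℝ) × (B.Scenario → ℝ) => B.F w.1 w.2)
    (f := fun q => (q, μ)) p h.2.2 (by fun_prop) fun _ hq => ⟨hq, mem_univ _⟩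

/-! ### Gradients at boundary points and the Clarke hull -/

/-- The gradient in `p` associated with a family of minimizers. -/
def mixRate (μ : B.Scenario → ℝ) (y : B.Scenario → Fin K → ℝ) (i : Fin K) : ℝ :=
  ∑ x, μ x * B.rate (y x) i

theorem F_eq {p : Fin K → ℝ} (hp : p ∈ orthant K) {μ : B.Scenario → ℝ}
    {y : B.Scenario → Fin K → ℝ} (hy : ∀ x, B.IsBoundedMinimizer p x (y x)) :
    B.F p μ = ∑ i, p i * B.mixRate μ y i := by
  simp only [F, mixRate, Finset.mul_sum]
  rw [Finset.sum_comm]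
  refine Finset.sum_congr rfl fun x _ => ?_
  rw [B.D_eq_energy hp (hy x).1, energy, Finset.mul_sum]
  refine Finset.sum_congr rfl fun i _ => ?_
  ring

theorem F_le {p : Fin K → ℝ} (hp : p ∈ orthant K) {μ : B.Scenario → ℝ} (hμ : ∀ x, 0 ≤ μ x)
    {y : B.Scenario → Fin K → ℝ} (hy : ∀ x, y x ∈ B.slice x) :
    B.F p μ ≤ ∑ i, p i * B.mixRate μ y i := by
  simp only [F, mixRate, Finset.mul_sum]
  rw [Finset.sum_comm]
  refine Finset.sum_le_sum fun x _ => ?_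
  refine (mul_le_mul_of_nonneg_left (B.D_le_energy hp (hy x)) (hμ x)).trans_eq ?_
  rw [energy, Finset.mul_sum]
  refine Finset.sum_congr rfl fun i _ => ?_
  ring

theorem tendsto_mixRate {μ : ℕ → B.Scenario → ℝ} {y : ℕ → B.Scenario → Fin K → ℝ}
    {μ₀ : B.Scenario → ℝ} {y₀ : B.Scenario → Fin K → ℝ} (hμ : Tendsto μ atTop (𝓝 μ₀))
    (hy : ∀ x, Tendsto (fun n => y n x) atTop (𝓝 (y₀ x))) (i : Fin K) :
    Tendsto (fun n => B.mixRate (μ n) (y n) i) atTop (𝓝 (B.mixRate μ₀ y₀ i)) :=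
  tendsto_finsetSum _ fun x _ => (tendsto_pi_nhds.1 hμ x).mul
    (((continuous_apply i).comp B.continuous_rate).continuousAt.tendsto.comp (hy x))

theorem tendsto_slope_of_hasFDerivWithinAt {E : Type*} [NormedAddCommGroup E] [NormedSpace ℝ E]
    {G : E → ℝ} {f : E →L[ℝ] ℝ} {s : Set E} {p v : E} (h : HasFDerivWithinAt G f s p)
    (hv : ∀ᶠ n : ℕ in atTop, p + (1 / ((n : ℝ) + 1)) • v ∈ s) :
    Tendsto (fun n : ℕ => ((n : ℝ) + 1) * (G (p + (1 / ((n : ℝ) + 1)) • v) - G p)) atTop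
      (𝓝 (f v)) := by
  refine h.lim (c := fun n : ℕ => (n : ℝ) + 1) (d := fun n : ℕ => (1 / ((n : ℝ) + 1)) • v) ?_ hv ?_
  · simpa using (tendsto_one_div_add_atTop_nhds_zero_nat (𝕜 := ℝ)).smul_const v
  · refine tendsto_const_nhds.congr fun n => ?_
    have : (n : ℝ) + 1 ≠ 0 := by positivity
    rw [smul_smul, mul_one_div_cancel this, one_smul]

theorem uniform_mem_stdSimplex (i₀ : Fin K) :
    (fun _ : Fin K => 1 / (K : ℝ)) ∈ stdSimplex ℝ (Fin K) := by
  have hK : (0 : ℝ) < K := by exact_mod_cast i₀.pos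
  refine ⟨fun _ => by positivity, ?_⟩
  simp [hK.ne']

theorem fderivWithin_D {p : Fin K → ℝ} (hp : p ∈ orthant K)
    (hS : B.activeSpan p = B.fullSpan) {x : B.Scenario} {y : Fin K → ℝ}
    (hy : B.IsBoundedMinimizer p x y) (i : Fin K) :
    fderivWithin ℝ (fun q => B.D q x) (orthant K) p (Pi.single i 1) = B.rate y i := by
  rw [(B.hasFDerivWithinAt_D hp hS hy).fderivWithin (uniqueDiffOn_orthant p hp), coeffCLM_single]

/-- At a point of differentiability, the gradient of `F(·, μ)` is the rate of some minimizers
that are limits of minimizers at interior weights. -/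
theorem exists_minimizers_gradP_eq {p : Fin K → ℝ} {μ : B.Scenario → ℝ}
    (hp : p ∈ stdSimplex ℝ (Fin K)) (hμ : ∀ x, 0 ≤ μ x)
    (hd : DifferentiableWithinAt ℝ (fun q => B.F q μ) (orthant K) p) :
    ∃ y : B.Scenario → Fin K → ℝ, (∀ x, B.IsBoundedMinimizer p x (y x)) ∧
      (∀ M, B.IsGradientBound M → ∀ x i, B.rate (y x) i ≤ M) ∧
      B.gradP p μ = B.mixRate μ y := by
  set f := fderivWithin ℝ (fun q => B.F q μ) (orthant K) p with hfdef
  have hf : HasFDerivWithinAt (fun q => B.F q μ) f (orthant K) p := hd.hasFDerivWithinAt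
  set u : Fin K → ℝ := fun _ => 1 / (K : ℝ) with hu
  have hK : (0 : ℝ) < K := by exact_mod_cast B.best.pos
  have hupos : ∀ i, 0 < u i := fun i => by simp only [hu]; positivity
  have huS : u ∈ stdSimplex ℝ (Fin K) := uniform_mem_stdSimplex B.best
  -- The point is approached along the segment to the uniform allocation, where all weights are
  -- positive and Danskin's formula holds.
  set q : ℕ → Fin K → ℝ := fun n => p + (1 / ((n : ℝ) + 1)) • (u - p) with hq
  have hs0 : ∀ n : ℕ, (0 : ℝ) < 1 / ((n : ℝ) + 1) := fun n => by positivity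
  have hs1 : ∀ n : ℕ, 1 / ((n : ℝ) + 1) ≤ 1 := fun n => by
    rw [div_le_one (by positivity)]; linarith [(Nat.cast_nonneg n : (0 : ℝ) ≤ n)]
  have hqS : ∀ n, q n ∈ stdSimplex ℝ (Fin K) := fun n =>
    (convex_stdSimplex ℝ (Fin K)).add_smul_sub_mem hp huS ⟨(hs0 n).le, hs1 n⟩
  have hqpos : ∀ n i, 0 < q n i := by
    intro n i
    have h1 := hp.1 i
    have h2 : q n i = (1 - 1 / ((n : ℝ) + 1)) * p i + 1 / ((n : ℝ) + 1) * u i := by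
      simp only [hq, Pi.add_apply, Pi.smul_apply, Pi.sub_apply, smul_eq_mul]; ring
    rw [h2]
    exact add_pos_of_nonneg_of_pos (mul_nonneg (sub_nonneg.2 (hs1 n)) h1)
      (mul_pos (hs0 n) (hupos i))
  have hslim : Tendsto (fun n : ℕ => 1 / ((n : ℝ) + 1)) atTop (𝓝 0) :=
    tendsto_one_div_add_atTop_nhds_zero_nat
  have hqlim : Tendsto q atTop (𝓝 p) := by
    have := (hslim.smul_const (u - p)).const_add p
    rwa [zero_smul, add_zero] at this
  set y : ℕ → B.Scenario → Fin K → ℝ := fun n x => B.minimizer (q n) x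
  have hy : ∀ n x, B.IsBoundedMinimizer (q n) x (y n x) := fun n x =>
    B.minimizer_spec (hqS n).1 x
  obtain ⟨y₀, φ, hφ, hlim⟩ := B.exists_subseq_tendsto fun n x => (hy n x).2
  have hy₀ : ∀ x, B.IsBoundedMinimizer p x (y₀ x) := fun x =>
    B.isBoundedMinimizer_of_tendsto (fun n => hy (φ n) x) (hqlim.comp hφ.tendsto_atTop) (hlim x)
  refine ⟨y₀, hy₀, fun M hM x i => ?_, ?_⟩
  -- The bound `M` applies to the rates at the interior points, where they are genuine partial
  -- derivatives, and passes to the limit.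
  · have h1 : Tendsto (fun n => B.rate (y (φ n) x) i) atTop (𝓝 (B.rate (y₀ x) i)) :=
      ((continuous_apply i).comp B.continuous_rate).continuousAt.tendsto.comp (hlim x)
    refine le_of_tendsto h1 (Eventually.of_forall fun n => ?_)
    have hS := B.activeSpan_of_pos (hqpos (φ n))
    have h2 := hM x _ (hqS (φ n)) (B.hasFDerivWithinAt_D (hqS (φ n)).1 hS
      (hy (φ n) x)).differentiableWithinAt i
    rw [B.fderivWithin_D (hqS (φ n)).1 hS (hy (φ n) x)] at h2
    exact (le_abs_self _).trans h2
  set G := B.mixRate μ y₀ with hG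
  -- The payoff lies below the linear function with coefficients `G` and touches it at `p`, which
  -- bounds the derivative in every feasible direction.
  have hupper : ∀ v : Fin K → ℝ,
      (∀ᶠ n : ℕ in atTop, p + (1 / ((n : ℝ) + 1)) • v ∈ orthant K) → f v ≤ ∑ i, v i * G i := by
    intro v hv
    refine le_of_tendsto (tendsto_slope_of_hasFDerivWithinAt hf hv) ?_
    filter_upwards [hv] with n hn
    have h1 := B.F_le hn hμ fun x => (hy₀ x).1.1
    have h2 := B.F_eq hp.1 (μ := μ) hy₀
    have h3 : ∑ i, (p + (1 / ((n : ℝ) + 1)) • v) i * B.mixRate μ y₀ i =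
        ∑ i, p i * B.mixRate μ y₀ i + 1 / ((n : ℝ) + 1) * ∑ i, v i * B.mixRate μ y₀ i := by
      rw [Finset.mul_sum, ← Finset.sum_add_distrib]
      refine Finset.sum_congr rfl fun i _ => ?_
      simp only [Pi.add_apply, Pi.smul_apply, smul_eq_mul]; ring
    have hn1 : (0 : ℝ) < (n : ℝ) + 1 := by positivity
    calc ((n : ℝ) + 1) * (B.F (p + (1 / ((n : ℝ) + 1)) • v) μ - B.F p μ)
        ≤ ((n : ℝ) + 1) * (1 / ((n : ℝ) + 1) * ∑ i, v i * B.mixRate μ y₀ i) := by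
          refine mul_le_mul_of_nonneg_left ?_ hn1.le
          linarith
      _ = _ := by rw [← mul_assoc, mul_one_div_cancel hn1.ne', one_mul]
  have hle : ∀ i, B.gradP p μ i ≤ G i := by
    intro i
    refine (hupper (Pi.single i 1) (Eventually.of_forall fun n j => ?_)).trans_eq ?_
    · have h1 := hp.1 j
      have h2 : (0 : ℝ) ≤ (Pi.single i 1 : Fin K → ℝ) j := by
        simp only [Pi.single_apply]; split_ifs <;> norm_num
      have h3 := (hs0 n).le
      simp only [Pi.add_apply, Pi.smul_apply, smul_eq_mul]
      positivity
    · simp [Pi.single_apply]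
  -- Decreasing a coordinate is feasible only when it is positive, so zero coordinates need a
  -- separate argument.
  have hge : ∀ i, 0 < p i → G i ≤ B.gradP p μ i := by
    intro i hi
    have h1 := hupper (-Pi.single i 1) ?_
    · simp only [map_neg, Pi.neg_apply, neg_mul, Finset.sum_neg_distrib, Pi.single_apply, ite_mul,
        one_mul, zero_mul, Finset.sum_ite_eq', Finset.mem_univ, if_true, neg_le_neg_iff] at h1
      exact h1
    · filter_upwards [hslim.eventually (gt_mem_nhds hi)] with n hn j
      simp only [Pi.add_apply, Pi.smul_apply, smul_eq_mul, Pi.neg_apply, Pi.single_apply]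
      have := hp.1 j
      split_ifs with hj
      · subst hj; linarith
      · simpa using this
  -- In the inward direction `u - p`, the minimizers along the segment bound the difference
  -- quotients from below, and these bounds tend to the pairing with `G`.
  have hlower : ∑ i, (u i - p i) * G i ≤ f (u - p) := by
    have h1 := tendsto_slope_of_hasFDerivWithinAt hf (v := u - p)
      (Eventually.of_forall fun n => (hqS n).1)
    have h2 : Tendsto (fun n => ∑ i, (u i - p i) * B.mixRate μ (y (φ n)) i) atTop
        (𝓝 (∑ i, (u i - p i) * G i)) :=
      tendsto_finsetSum _ fun i _ => (B.tendsto_mixRate tendsto_const_nhds hlim i).const_mul _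
    refine le_of_tendsto_of_tendsto' h2 (h1.comp hφ.tendsto_atTop) fun n => ?_
    simp only [Function.comp_apply]
    have e1 := B.F_le hp.1 hμ fun x => (hy (φ n) x).1.1
    have e2 := B.F_eq (hqS (φ n)).1 (μ := μ) fun x => hy (φ n) x
    have e3 : ∑ i, (q (φ n)) i * B.mixRate μ (y (φ n)) i =
        ∑ i, p i * B.mixRate μ (y (φ n)) i +
          1 / ((φ n : ℝ) + 1) * ∑ i, (u i - p i) * B.mixRate μ (y (φ n)) i := by
      rw [Finset.mul_sum, ← Finset.sum_add_distrib]
      refine Finset.sum_congr rfl fun i _ => ?_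
      simp only [hq, Pi.add_apply, Pi.smul_apply, smul_eq_mul, Pi.sub_apply]; ring
    have hn1 : (0 : ℝ) < (φ n : ℝ) + 1 := by positivity
    calc ∑ i, (u i - p i) * B.mixRate μ (y (φ n)) i
        = ((φ n : ℝ) + 1) *
          (1 / ((φ n : ℝ) + 1) * ∑ i, (u i - p i) * B.mixRate μ (y (φ n)) i) := by
          rw [← mul_assoc, mul_one_div_cancel hn1.ne', one_mul]
      _ ≤ _ := by
          refine mul_le_mul_of_nonneg_left ?_ hn1.le
          change _ ≤ B.F (q (φ n)) μ - B.F p μ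
          linarith
  have hfv : f (u - p) = ∑ i, (u i - p i) * B.gradP p μ i := by
    conv_lhs => rw [pi_eq_sum_univ' (u - p)]
    simp only [map_sum, map_smul, smul_eq_mul, Pi.sub_apply]
    refine Finset.sum_congr rfl fun i _ => ?_
    congr 1
  -- A sum of nonnegative terms is nonpositive, so each term vanishes; `u i > 0` settles the
  -- coordinates with `p i = 0`.
  have hzero : ∑ i, (u i - p i) * (G i - B.gradP p μ i) ≤ 0 := by
    simp only [mul_sub, Finset.sum_sub_distrib]
    linarith
  have hnn : ∀ i ∈ Finset.univ, 0 ≤ (u i - p i) * (G i - B.gradP p μ i) := by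
    intro i _
    rcases (hp.1 i).eq_or_lt with h0 | h0
    · have h1 := hle i
      have h2 := (hupos i).le
      rw [← h0, sub_zero]
      exact mul_nonneg h2 (sub_nonneg.2 h1)
    · rw [le_antisymm (hle i) (hge i h0), sub_self, mul_zero]
  ext i
  rcases (hp.1 i).eq_or_lt with h0 | h0
  · have h1 := (Finset.sum_eq_zero_iff_of_nonneg hnn).1
      (le_antisymm hzero (Finset.sum_nonneg hnn)) i (Finset.mem_univ i)
    rw [← h0, sub_zero] at h1
    have := (mul_eq_zero.1 h1).resolve_left (hupos i).ne'
    linarith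
  · exact le_antisymm (hle i) (hge i h0)

theorem rate_le_of_norm_le {y : Fin K → ℝ} (hy : ‖y‖ ≤ B.radius) (i : Fin K) :
    B.rate y i ≤ B.radius ^ 2 / (2 * (B.σ i : ℝ) ^ 2) := by
  have e : |y i| ≤ B.radius := (norm_le_pi_norm y i).trans hy
  unfold rate
  exact div_le_div_of_nonneg_right (sq_le_sq' (abs_le.1 e).1 (abs_le.1 e).2) (by positivity)

theorem rate_le_sum {y : Fin K → ℝ} (hy : ‖y‖ ≤ B.radius) (i : Fin K) :
    B.rate y i ≤ ∑ i, B.radius ^ 2 / (2 * (B.σ i : ℝ) ^ 2) :=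
  (B.rate_le_of_norm_le hy i).trans
    (Finset.single_le_sum (f := fun i => B.radius ^ 2 / (2 * (B.σ i : ℝ) ^ 2))
      (fun _ _ => by positivity) (Finset.mem_univ i))

theorem F_single (q : Fin K → ℝ) (x : B.Scenario) : B.F q (Pi.single x 1) = B.D q x := by
  simp [F, Pi.single_apply]

/-- `D(·, x)` is the payoff at a point mass, so wherever it is differentiable its partials are rates
of a minimizer in the ball of size `radius`. -/
theorem exists_isGradientBound : ∃ M : ℝ, B.IsGradientBound M := by
  refine ⟨∑ i, B.radius ^ 2 / (2 * (B.σ i : ℝ) ^ 2), fun x p hp hd i => ?_⟩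
  have hF : (fun q => B.D q x) = fun q => B.F q (Pi.single x 1) := by
    ext q; rw [F_single]
  rw [hF] at hd ⊢
  obtain ⟨y, hy, -, hg⟩ := B.exists_minimizers_gradP_eq hp (μ := Pi.single x 1) (fun z => by
    simp only [Pi.single_apply]; split_ifs <;> norm_num) hd
  change |B.gradP p (Pi.single x 1) i| ≤ _
  have h1 : B.mixRate (Pi.single x 1) y i = B.rate (y x) i := by
    simp [mixRate, Pi.single_apply]
  rw [hg, h1, abs_of_nonneg (B.rate_nonneg _ _)]
  exact B.rate_le_sum (hy x).2 i

/-- The Clarke gradient is contained in the convex hull of rates of minimizers. -/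
theorem clarkeP_subset {p : Fin K → ℝ} {μ : B.Scenario → ℝ} {M : ℝ} (hM : B.IsGradientBound M) :
    B.clarkeP p μ ⊆ convexHull ℝ {f | ∃ y : B.Scenario → Fin K → ℝ,
      (∀ x, B.IsBoundedMinimizer p x (y x)) ∧ (∀ x i, B.rate (y x) i ≤ M) ∧
      f = B.mixRate μ y} := by
  refine convexHull_mono ?_
  rintro f ⟨z, hz, hzlim, hflim⟩
  choose y hy hyM hyg using fun n => B.exists_minimizers_gradP_eq (hz n).1 (hz n).2.1.1
    (B.differentiableWithinAt_F_of_mem_diffSet (hz n))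
  obtain ⟨y₀, φ, hφ, hlim⟩ := B.exists_subseq_tendsto fun n x => (hy n x).2
  have h1 : Tendsto (fun n => (z n).1) atTop (𝓝 p) := hzlim.fst_nhds
  have h2 : Tendsto (fun n => (z n).2) atTop (𝓝 μ) := hzlim.snd_nhds
  refine ⟨y₀, fun x => B.isBoundedMinimizer_of_tendsto (fun n => hy (φ n) x)
    (h1.comp hφ.tendsto_atTop) (hlim x), fun x i => ?_, ?_⟩
  · have h3 : Tendsto (fun n => B.rate (y (φ n) x) i) atTop (𝓝 (B.rate (y₀ x) i)) :=
      ((continuous_apply i).comp B.continuous_rate).continuousAt.tendsto.comp (hlim x)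
    exact le_of_tendsto h3 (Eventually.of_forall fun n => hyM (φ n) M hM x i)
  · ext i
    refine tendsto_nhds_unique ((tendsto_pi_nhds.1 hflim i).comp hφ.tendsto_atTop) ?_
    refine (B.tendsto_mixRate (h2.comp hφ.tendsto_atTop) hlim i).congr fun n => ?_
    simp only [Function.comp_apply, hyg]


/-! ### Linear oracles -/

theorem gradMu_eq (p : Fin K → ℝ) (μ : B.Scenario → ℝ) (x : B.Scenario) :
    B.gradMu p μ x = B.D p x := by
  set L : (B.Scenario → ℝ) →L[ℝ] ℝ :=
    ∑ x, B.D p x • ContinuousLinearMap.proj (R := ℝ) (φ := fun _ : B.Scenario => ℝ) x with hL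
  have hF : (fun ν => B.F p ν) = L := by
    ext ν
    simp [F, hL, mul_comm]
  rw [gradMu, hF, L.fderiv]
  simp [hL, Pi.single_apply]

theorem single_mem_stdSimplex' {ι : Type*} [Fintype ι] [DecidableEq ι] (i : ι) :
    (Pi.single i 1 : ι → ℝ) ∈ stdSimplex ℝ ι := single_mem_stdSimplex ℝ i

theorem sum_mul_D_le_of_mem_LMOmu {p : Fin K → ℝ} {μ ν : B.Scenario → ℝ}
    (hν : ν ∈ B.LMOmu p μ) (x : B.Scenario) : ∑ z, ν z * B.D p z ≤ B.D p x := by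
  have := hν.2 _ (single_mem_stdSimplex' x)
  simpa [gradMu_eq, Pi.single_apply] using this

/-- The smallest information is zero, so an optimal mixture averages nonnegative quantities to zero.
-/
theorem eq_zero_of_mem_LMOmu {p : Fin K → ℝ} (hp : p ∈ orthant K) {μ ν : B.Scenario → ℝ}
    (hν : ν ∈ B.LMOmu p μ) {x x₀ : B.Scenario} (h₀ : B.D p x₀ = 0) (hx : B.D p x ≠ 0) :
    ν x = 0 := by
  have h1 := B.sum_mul_D_le_of_mem_LMOmu hν x₀
  rw [h₀] at h1
  have hnn : ∀ z ∈ Finset.univ, 0 ≤ ν z * B.D p z := fun z _ =>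
    mul_nonneg (hν.1.1 z) (B.D_nonneg hp z)
  have h2 := (Finset.sum_eq_zero_iff_of_nonneg hnn).1 (le_antisymm h1 (Finset.sum_nonneg hnn)) x
    (Finset.mem_univ x)
  exact (mul_eq_zero.1 h2).resolve_right hx

/-- A maximizer of a linear functional on the simplex does not charge non-maximal coordinates. -/
theorem eq_zero_of_forall_sum_mul_le {ι : Type*} [Fintype ι] [DecidableEq ι] {q f : ι → ℝ}
    (hq : q ∈ stdSimplex ℝ ι)
    (hmax : ∀ q' ∈ stdSimplex ℝ ι, ∑ i, q' i * f i ≤ ∑ i, q i * f i) {i j : ι}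
    (hij : f i < f j) : q i = 0 := by
  obtain ⟨k, hk⟩ := @Finite.exists_max ι ℝ _ ⟨i⟩ _ f
  have h1 := hmax _ (single_mem_stdSimplex' k)
  simp only [Pi.single_apply, ite_mul, one_mul, zero_mul, Finset.sum_ite_eq', Finset.mem_univ,
    if_true] at h1
  have h2 : ∑ z, q z * (f k - f z) ≤ 0 := by
    simp only [mul_sub, Finset.sum_sub_distrib, ← Finset.sum_mul, hq.2]
    linarith
  have hnn : ∀ z ∈ Finset.univ, 0 ≤ q z * (f k - f z) := fun z _ =>
    mul_nonneg (hq.1 z) (sub_nonneg.2 (hk z))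
  have h3 := (Finset.sum_eq_zero_iff_of_nonneg hnn).1 (le_antisymm h2 (Finset.sum_nonneg hnn)) i
    (Finset.mem_univ i)
  exact (mul_eq_zero.1 h3).resolve_right (by linarith [hk j] : 0 < f k - f i).ne'

/-- At the uniform allocation `D` is positive and is the weighted sum of its partials, so these
cannot all be nonpositive. -/
theorem IsGradientBound.pos {M : ℝ} (hM : B.IsGradientBound M) (x : B.Scenario) : 0 < M := by
  have hK : (0 : ℝ) < K := by exact_mod_cast B.best.pos
  have hu := uniform_mem_stdSimplex B.best
  have hS := B.activeSpan_of_pos (p := fun _ => 1 / (K : ℝ)) fun i => by positivity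
  have h1 := B.D_pos_of_activeSpan_eq hu.1 hS x
  have hy := B.minimizer_spec hu.1 x
  rw [B.D_eq hu.1] at h1
  by_contra hneg
  refine h1.not_ge (Finset.sum_nonpos fun i _ => ?_)
  have h2 := hM x _ hu (B.hasFDerivWithinAt_D hu.1 hS hy).differentiableWithinAt i
  rw [B.fderivWithin_D hu.1 hS hy] at h2
  have h3 := (le_abs_self _).trans (h2.trans (not_lt.1 hneg))
  exact mul_nonpos_of_nonneg_of_nonpos (hu.1 i) h3

theorem gapMin_le (x : B.Scenario) : B.gapMin ≤ B.gap x := by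
  rw [gap, delta, inner_sub_left]
  exact ciInf_le (Set.finite_range _).bddBelow x

theorem gapMin_pos (x : B.Scenario) : 0 < B.gapMin := by
  have : Nonempty B.Scenario := ⟨x⟩
  obtain ⟨z, hz⟩ := exists_eq_ciInf_of_finite
    (f := fun x : B.Scenario => (inner ℝ (B.a B.best) B.θ - inner ℝ (B.a x) B.θ : ℝ))
  rw [gapMin, ← hz]
  have := B.gap_pos z
  rwa [gap, delta, inner_sub_left] at this

/-! ### Positivity of the constants and the outside-arm bound -/

section Constants

variable {S : Submodule ℝ (EuclideanSpace ℝ (Fin d))}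

theorem exists_a_notMem (hS : S < B.fullSpan) : ∃ j, B.a j ∉ S := by
  by_contra h
  push Not at h
  refine hS.not_ge (Submodule.span_le.2 ?_)
  rintro _ ⟨j, rfl⟩
  exact h j

theorem exists_unit_mem (hS : S < B.fullSpan) :
    ∃ u : EuclideanSpace ℝ (Fin d), u ∈ Sᗮ ⊓ B.fullSpan ∧ ‖u‖ = 1 := by
  have h := Submodule.sup_orthogonal_inf_of_hasOrthogonalProjection hS.le
  have hne : Sᗮ ⊓ B.fullSpan ≠ ⊥ := by
    intro h0
    rw [h0, sup_bot_eq] at h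
    exact hS.ne h
  obtain ⟨u, hu, hu0⟩ := Submodule.exists_mem_ne_zero_of_ne_bot hne
  refine ⟨(‖u‖)⁻¹ • u, Submodule.smul_mem _ _ hu, ?_⟩
  rw [norm_smul, norm_inv, norm_norm, inv_mul_cancel₀ (norm_pos_iff.2 hu0).ne']

theorem eq_zero_of_mem_fullSpan {u : EuclideanSpace ℝ (Fin d)} (hu : u ∈ B.fullSpan)
    (h : ∀ j, inner ℝ (B.a j) u = 0) : u = 0 := by
  have : B.fullSpan ≤ (Submodule.span ℝ {u})ᗮ := by
    refine Submodule.span_le.2 ?_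
    rintro _ ⟨i, rfl⟩
    rw [SetLike.mem_coe, Submodule.mem_orthogonal_singleton_iff_inner_left]
    exact h i
  exact inner_self_eq_zero.1 (Submodule.mem_orthogonal_singleton_iff_inner_left.1 (this hu))

theorem gam_le {u : EuclideanSpace ℝ (Fin d)} (hu : u ∈ Sᗮ ⊓ B.fullSpan) (hu1 : ‖u‖ = 1) :
    B.gam S ≤ ⨆ j : B.Outside S, (inner ℝ (B.a j) u) ^ 2 / (B.σ j : ℝ) ^ 2 := by
  refine ciInf_le (f := fun u : {u : EuclideanSpace ℝ (Fin d) // u ∈ Sᗮ ⊓ B.fullSpan ∧ ‖u‖ = 1} =>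
    ⨆ j : B.Outside S, (inner ℝ (B.a j) (u : EuclideanSpace ℝ (Fin d))) ^ 2 / (B.σ j : ℝ) ^ 2)
    ⟨0, ?_⟩ ⟨u, hu, hu1⟩
  rintro _ ⟨v, rfl⟩
  exact Real.iSup_nonneg fun j => by positivity

/-- A nonzero vector of `Sᗮ ⊓ ℋ` is seen by some arm, necessarily outside `S`. Compactness is
applied to the sum over outside arms, continuous by inspection, which exceeds the maximum by at most
the factor `|O(S)|`. -/
theorem gam_pos (hS : S < B.fullSpan) : 0 < B.gam S := by
  classical
  set s : Set (EuclideanSpace ℝ (Fin d)) :=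
    ((Sᗮ ⊓ B.fullSpan : Submodule ℝ (EuclideanSpace ℝ (Fin d))) :
      Set (EuclideanSpace ℝ (Fin d))) ∩ Metric.sphere 0 1
  have hcpt : IsCompact s :=
    (isCompact_sphere _ _).inter_left (Submodule.closed_of_finiteDimensional _)
  obtain ⟨j₀, hj₀⟩ := B.exists_a_notMem hS
  have : Nonempty (B.Outside S) := ⟨⟨j₀, hj₀⟩⟩
  set g : EuclideanSpace ℝ (Fin d) → ℝ := fun u =>
    ∑ j : B.Outside S, (inner ℝ (B.a j) u) ^ 2 / (B.σ j : ℝ) ^ 2 with hg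
  have hcont : Continuous g := by
    refine continuous_finsetSum _ fun j _ => ?_
    exact ((continuous_const.inner continuous_id).pow 2).div_const _
  have hpos : ∀ u ∈ s, 0 < g u := by
    rintro u ⟨hu, hu1⟩
    obtain ⟨j, hj⟩ : ∃ j, inner ℝ (B.a j) u ≠ 0 := by
      by_contra h
      push Not at h
      rw [B.eq_zero_of_mem_fullSpan hu.2 h] at hu1
      simp at hu1
    have hjS : B.a j ∉ S := fun h => hj ((Submodule.mem_orthogonal S u).1 hu.1 _ h)
    refine Finset.sum_pos' (fun i _ => by positivity) ⟨⟨j, hjS⟩, Finset.mem_univ _, ?_⟩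
    have := B.σ_pos' j
    positivity
  obtain ⟨c, hc, hmin⟩ := hcpt.exists_forall_le' hcont.continuousOn hpos
  obtain ⟨u₀, hu₀⟩ := B.exists_unit_mem hS
  have : Nonempty {u : EuclideanSpace ℝ (Fin d) // u ∈ Sᗮ ⊓ B.fullSpan ∧ ‖u‖ = 1} := ⟨⟨u₀, hu₀⟩⟩
  have hcard : (0 : ℝ) < Fintype.card (B.Outside S) := by exact_mod_cast Fintype.card_pos
  refine (div_pos hc hcard).trans_le (le_ciInf fun u => ?_)
  rw [div_le_iff₀ hcard]
  refine (hmin u ⟨u.2.1, by simpa using u.2.2⟩).trans ?_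
  calc g u ≤ ∑ _j : B.Outside S, ⨆ j : B.Outside S,
        (inner ℝ (B.a j) (u : EuclideanSpace ℝ (Fin d))) ^ 2 / (B.σ j : ℝ) ^ 2 :=
        Finset.sum_le_sum fun j _ => le_ciSup (f := fun j : B.Outside S =>
          (inner ℝ (B.a j) (u : EuclideanSpace ℝ (Fin d))) ^ 2 / (B.σ j : ℝ) ^ 2)
          (Set.finite_range _).bddAbove j
    _ = _ := by simp [mul_comm]

theorem le_rho (x : B.Scenario) : ‖Sᗮ.starProjection (B.delta x)‖ ^ 2 ≤ B.rho S :=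
  le_ciSup (f := fun x => ‖Sᗮ.starProjection (B.delta x)‖ ^ 2) (Set.finite_range _).bddAbove x

theorem rho_pos {x : B.Scenario} (hx : B.delta x ∉ S) : 0 < B.rho S := by
  refine lt_of_lt_of_le ?_ (B.le_rho x)
  have : Sᗮ.starProjection (B.delta x) ≠ 0 := by
    intro h
    rw [Submodule.starProjection_apply_eq_zero_iff, Submodule.orthogonal_orthogonal] at h
    exact hx h
  positivity

theorem mconst_pos (hS : S < B.fullSpan) {x : B.Scenario} (hx : B.delta x ∉ S) :
    0 < B.mconst S := by
  have h1 := B.gapMin_pos x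
  have h2 := B.gam_pos hS
  have h3 := B.rho_pos hx
  unfold mconst
  positivity

theorem card_outside_pos (hS : S < B.fullSpan) : (0 : ℝ) < Nat.card (B.Outside S) := by
  obtain ⟨j, hj⟩ := B.exists_a_notMem hS
  have : Nonempty (B.Outside S) := ⟨⟨j, hj⟩⟩
  exact_mod_cast Nat.card_pos

theorem epsS_pos {M : ℝ} (hM : B.IsGradientBound M) (hS : S < B.fullSpan) {x : B.Scenario}
    (hx : B.delta x ∉ S) : 0 < B.epsS M S := by
  have h1 := B.mconst_pos hS hx
  have h2 := B.card_outside_pos hS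
  have h3 := IsGradientBound.pos B hM x
  unfold epsS
  positivity

theorem epsS_le_half (M : ℝ) : B.epsS M S ≤ 1 / 2 := min_le_left _ _

theorem epsS_mul_le {M : ℝ} (hM : B.IsGradientBound M) (hS : S < B.fullSpan) (x : B.Scenario) :
    B.epsS M S * M ≤ B.mconst S / (4 * (Nat.card (B.Outside S) : ℝ)) := by
  have h2 := B.card_outside_pos hS
  have h3 := IsGradientBound.pos B hM x
  calc B.epsS M S * M ≤ B.mconst S / (4 * (Nat.card (B.Outside S) : ℝ) * M) * M := by
        gcongr; exact min_le_right _ _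
    _ = _ := by field_simp

/-- A shift orthogonal to `S` can close the gap only through the component of `δ_x` in `Sᗮ`.
Cauchy–Schwarz makes its squared norm at least `gapMin² / ρ(S)`, and `γ(S)` provides an outside arm
that sees it. -/
theorem exists_mconst_le_rate (hS : S < B.fullSpan) {x : B.Scenario} (hx : B.delta x ∉ S)
    {h : EuclideanSpace ℝ (Fin d)} (hh : h ∈ Sᗮ) (hgap : inner ℝ (B.delta x) h = B.gap x) :
    ∃ j, B.a j ∉ S ∧ B.mconst S ≤ B.rate (B.response h) j := by
  set H := B.fullSpan
  -- Projecting to `ℋ` changes no inner product with a feature and gives a vector that `γ(S)` tests.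
  set k := H.starProjection h with hk
  have hkH : k ∈ H := Submodule.starProjection_apply_mem _ _
  have hin : ∀ v ∈ H, inner ℝ v k = inner ℝ v h := by
    intro v hv
    have : inner ℝ (h - k) v = 0 := Submodule.starProjection_inner_eq_zero _ _ hv
    rw [real_inner_comm, inner_sub_right] at this
    linarith
  have hδ : B.delta x ∈ H := sub_mem (B.a_mem_fullSpan _) (B.a_mem_fullSpan _)
  have hkS : k ∈ Sᗮ := by
    rw [Submodule.mem_orthogonal]
    intro v hv
    rw [hin v (hS.le hv)]
    exact (Submodule.mem_orthogonal S h).1 hh v hv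
  have hkgap : inner ℝ (B.delta x) k = B.gap x := by rw [hin _ hδ, hgap]
  have hg := B.gap_pos x
  have hk0 : 0 < ‖k‖ := by
    rw [norm_pos_iff]
    intro h0
    rw [h0, inner_zero_right] at hkgap
    exact hg.ne hkgap
  have hbound : B.gap x ≤ ‖Sᗮ.starProjection (B.delta x)‖ * ‖k‖ := by
    have h1 : inner ℝ (B.delta x - Sᗮ.starProjection (B.delta x)) k = 0 :=
      Submodule.starProjection_inner_eq_zero _ _ hkS
    rw [inner_sub_left, hkgap] at h1
    linarith [real_inner_le_norm (Sᗮ.starProjection (B.delta x)) k]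
  have hsq : B.gapMin ^ 2 ≤ B.rho S * ‖k‖ ^ 2 := by
    have h1 := B.gapMin_le x
    have h2 := B.gapMin_pos x
    calc B.gapMin ^ 2 ≤ (‖Sᗮ.starProjection (B.delta x)‖ * ‖k‖) ^ 2 := by
          gcongr; linarith
      _ = ‖Sᗮ.starProjection (B.delta x)‖ ^ 2 * ‖k‖ ^ 2 := by ring
      _ ≤ _ := by gcongr; exact B.le_rho x
  obtain ⟨j₀, hj₀⟩ := B.exists_a_notMem hS
  have : Nonempty (B.Outside S) := ⟨⟨j₀, hj₀⟩⟩
  have hγ := B.gam_le (S := S) (u := (‖k‖)⁻¹ • k) (Submodule.smul_mem _ _ ⟨hkS, hkH⟩) (by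
    rw [norm_smul, norm_inv, norm_norm, inv_mul_cancel₀ hk0.ne'])
  obtain ⟨j, hj⟩ := exists_eq_ciSup_of_finite (f := fun j : B.Outside S =>
    (inner ℝ (B.a j) ((‖k‖)⁻¹ • k)) ^ 2 / (B.σ j : ℝ) ^ 2)
  rw [← hj] at hγ
  refine ⟨j, j.2, ?_⟩
  have hσ := B.σ_pos' j
  have hρ := B.rho_pos hx
  have hγ0 := B.gam_pos hS
  rw [inner_smul_right, hin _ (B.a_mem_fullSpan _), mul_pow, inv_pow, inv_mul_eq_div,
    div_right_comm, le_div_iff₀ (by positivity)] at hγ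
  calc B.mconst S = B.gapMin ^ 2 / B.rho S * B.gam S / 2 := by unfold mconst; ring
    _ ≤ ‖k‖ ^ 2 * B.gam S / 2 := by
        have : B.gapMin ^ 2 / B.rho S ≤ ‖k‖ ^ 2 := by rw [div_le_iff₀ hρ]; linarith
        gcongr
    _ ≤ (inner ℝ (B.a j) h ^ 2 / (B.σ j : ℝ) ^ 2) / 2 := by linarith
    _ = _ := by rw [rate, response_apply]; field_simp

end Constants


end

end LinearBandit

/-! ### Differential inequalities for absolutely continuous functions -/

theorem AbsolutelyContinuousOnInterval.of_dist_le {X Y : Type*} [PseudoMetricSpace X]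
    [PseudoMetricSpace Y] {f : ℝ → X} {g : ℝ → Y} {a b C : ℝ}
    (hf : AbsolutelyContinuousOnInterval f a b)
    (h : ∀ s ∈ uIcc a b, ∀ t ∈ uIcc a b, dist (g s) (g t) ≤ C * dist (f s) (f t)) :
    AbsolutelyContinuousOnInterval g a b := by
  unfold AbsolutelyContinuousOnInterval at hf ⊢
  refine squeeze_zero' ?_ ?_ (by simpa using hf.const_mul C)
  · exact Eventually.of_forall fun _ => Finset.sum_nonneg fun i hi => dist_nonneg
  rw [eventually_inf_principal]
  filter_upwards with E hE
  rw [Finset.mul_sum]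
  exact Finset.sum_le_sum fun i hi => h _ (hE.1 i hi).1 _ (hE.1 i hi).2

theorem AbsolutelyContinuousOnInterval.apply {ι : Type*} [Fintype ι] {f : ℝ → ι → ℝ} {a b : ℝ}
    (hf : AbsolutelyContinuousOnInterval f a b) (i : ι) :
    AbsolutelyContinuousOnInterval (fun t => f t i) a b :=
  hf.of_dist_le (C := 1) fun s _ t _ => by rw [one_mul]; exact dist_le_pi_dist _ _ i

theorem AbsolutelyContinuousOnInterval.le_of_ae_deriv_nonneg {f : ℝ → ℝ} {a b : ℝ} (hab : a ≤ b)
    (hf : AbsolutelyContinuousOnInterval f a b) (h : ∀ᵐ t, t ∈ Ioo a b → 0 ≤ deriv f t) :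
    f a ≤ f b := by
  rw [← sub_nonneg, ← hf.integral_deriv_eq_sub, intervalIntegral.integral_of_le hab,
    integral_Ioc_eq_integral_Ioo]
  refine setIntegral_nonneg_of_ae_restrict ?_
  rw [EventuallyLE, ae_restrict_iff' measurableSet_Ioo]
  exact h

/-- If `f' + f ≥ 0` almost everywhere, then `exp t * f t` increases. -/
theorem AbsolutelyContinuousOnInterval.exp_mul_le_exp_mul {f : ℝ → ℝ} {a b : ℝ} (hab : a ≤ b)
    (hf : AbsolutelyContinuousOnInterval f a b)
    (h : ∀ᵐ t, t ∈ Ioo a b → ∃ v, 0 ≤ v ∧ HasDerivAt f (v - f t) t) :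
    Real.exp a * f a ≤ Real.exp b * f b := by
  have hexp : AbsolutelyContinuousOnInterval Real.exp a b :=
    Real.contDiff_exp.contDiffOn.absolutelyContinuousOnInterval
  refine (hexp.mul hf).le_of_ae_deriv_nonneg hab ?_
  filter_upwards [h] with t ht hmem
  obtain ⟨v, hv, hd⟩ := ht hmem
  rw [((Real.hasDerivAt_exp t).mul hd).deriv]
  have := Real.exp_pos t
  nlinarith [mul_nonneg this.le hv]

theorem exists_mem_Ioo_of_ae {P : ℝ → Prop} (h : ∀ᵐ t, P t) {a b : ℝ} (hab : a < b) :
    ∃ t ∈ Ioo a b, P t := by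
  obtain ⟨t, ht, hmem⟩ := (Measure.dense_of_ae h).exists_between hab
  exact ⟨t, hmem, ht⟩

/-! ### Lifetime of a proper active span -/

namespace LinearBandit

noncomputable section

variable {K d : ℕ} (B : LinearBandit K d)

theorem mem_orthogonal_activeSpan {p : Fin K → ℝ} {h : EuclideanSpace ℝ (Fin d)}
    (hh : ∀ i, 0 < p i → B.response h i = 0) : h ∈ (B.activeSpan p)ᗮ := by
  rw [Submodule.mem_orthogonal]
  exact fun v hv => B.inner_eq_zero_of_mem_activeSpan hh hv

/-- Where the adversary mostly plays zero-information scenarios, the linear oracle of the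
maximizing player only proposes arms that expand the active span. -/
theorem exists_pos_outside_of_mem_LMOp {p : Fin K → ℝ} {μ : B.Scenario → ℝ}
    (hp : p ∈ stdSimplex ℝ (Fin K)) (hμ : μ ∈ stdSimplex ℝ B.Scenario) {M : ℝ}
    (hM : B.IsGradientBound M) (hS : B.activeSpan p < B.fullSpan)
    (hε : ∑ x, (if B.D p x = 0 then 0 else μ x) ≤ B.epsS M (B.activeSpan p))
    {q : Fin K → ℝ} (hq : q ∈ B.LMOp p μ) : ∃ j, B.a j ∉ B.activeSpan p ∧ 0 < q j := by
  classical
  set S := B.activeSpan p with hSdef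
  obtain ⟨x₀, hx₀⟩ : ∃ x, B.D p x = 0 := by
    by_contra h
    push Not at h
    exact hS.ne ((B.zeroInfo_eq_empty_iff hp).1 (eq_empty_iff_forall_notMem.2 h))
  have hx₀S : B.delta x₀ ∉ S := (B.D_eq_zero_iff hp.1 x₀).1 hx₀
  have hm := B.mconst_pos hS hx₀S
  have hM0 := IsGradientBound.pos B hM x₀
  have hε1 := B.epsS_le_half (S := S) M
  have hεM := B.epsS_mul_le hM hS x₀
  have hcard := B.card_outside_pos hS
  have hcard' : ((Finset.univ.filter fun j => B.a j ∉ S).card : ℝ) = Nat.card (B.Outside S) := by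
    rw [Nat.card_eq_fintype_card, Fintype.card_subtype]
  set ε := B.epsS M S
  -- Both bounds define a convex set, so it suffices to check them on rates of minimizers, before
  -- taking the convex hull.
  set P : Set (Fin K → ℝ) := {f | (∀ i, B.a i ∈ S → f i ≤ ε * M) ∧
    (1 - ε) * B.mconst S ≤ ∑ j with B.a j ∉ S, f j} with hP
  have hPconv : Convex ℝ P := by
    intro f hf g hg s t hs ht hst
    refine ⟨fun i hi => ?_, ?_⟩
    · have h1 := hf.1 i hi
      have h2 := hg.1 i hi
      simp only [Pi.add_apply, Pi.smul_apply, smul_eq_mul]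
      calc s * f i + t * g i ≤ s * (ε * M) + t * (ε * M) := by gcongr
        _ = ε * M := by rw [← add_mul, hst, one_mul]
    · simp only [Pi.add_apply, Pi.smul_apply, smul_eq_mul, Finset.sum_add_distrib,
        ← Finset.mul_sum]
      calc (1 - ε) * B.mconst S = s * ((1 - ε) * B.mconst S) + t * ((1 - ε) * B.mconst S) := by
            rw [← add_mul, hst, one_mul]
        _ ≤ _ := by
            have h1 := hf.2
            have h2 := hg.2
            gcongr
  have hclarke : B.clarkeP p μ ⊆ P := by
    refine (B.clarkeP_subset hM).trans (convexHull_min ?_ hPconv)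
    rintro _ ⟨y, hy, hyM, rfl⟩
    have hzero : ∀ x, B.D p x = 0 → ∃ h ∈ Sᗮ, B.response h = y x ∧
        inner ℝ (B.delta x) h = B.gap x := by
      intro x hx
      obtain ⟨h, hh, hg⟩ := (hy x).1.1
      rw [B.D_eq_energy hp.1 (hy x).1, B.energy_eq_zero_iff hp.1, ← hh] at hx
      exact ⟨h, B.mem_orthogonal_activeSpan hx, hh, hg⟩
    refine ⟨fun i hi => ?_, ?_⟩
    · calc B.mixRate μ y i ≤ ∑ x, (if B.D p x = 0 then 0 else μ x) * M := by
            refine Finset.sum_le_sum fun x _ => ?_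
            split_ifs with hx
            · obtain ⟨h, hhS, hh, -⟩ := hzero x hx
              rw [← hh, rate, response_apply, (Submodule.mem_orthogonal S h).1 hhS _ hi]
              simp
            · exact mul_le_mul_of_nonneg_left (hyM x i) (hμ.1 x)
        _ ≤ ε * M := by
            rw [← Finset.sum_mul]
            exact mul_le_mul_of_nonneg_right hε hM0.le
    · have hsum : 1 - ε ≤ ∑ x, if B.D p x = 0 then μ x else 0 := by
        have h1 : ∑ x, (if B.D p x = 0 then μ x else 0) +
            ∑ x, (if B.D p x = 0 then 0 else μ x) = 1 := by
          rw [← Finset.sum_add_distrib, ← hμ.2]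
          refine Finset.sum_congr rfl fun x _ => ?_
          split_ifs <;> simp
        linarith
      calc (1 - ε) * B.mconst S ≤ (∑ x, if B.D p x = 0 then μ x else 0) * B.mconst S := by
            gcongr
        _ ≤ ∑ x, μ x * ∑ j with B.a j ∉ S, B.rate (y x) j := by
            rw [Finset.sum_mul]
            refine Finset.sum_le_sum fun x _ => ?_
            split_ifs with hx
            · obtain ⟨h, hhS, hh, hg⟩ := hzero x hx
              obtain ⟨j, hj, hmj⟩ := B.exists_mconst_le_rate hS
                ((B.D_eq_zero_iff hp.1 x).1 hx) hhS hg
              rw [hh] at hmj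
              refine mul_le_mul_of_nonneg_left (hmj.trans ?_) (hμ.1 x)
              exact Finset.single_le_sum (f := fun j => B.rate (y x) j)
                (fun k _ => B.rate_nonneg _ _) (by simpa using hj)
            · rw [zero_mul]
              exact mul_nonneg (hμ.1 x) (Finset.sum_nonneg fun k _ => B.rate_nonneg _ _)
        _ = ∑ j with B.a j ∉ S, B.mixRate μ y j := by
            simp only [mixRate, Finset.mul_sum]
            exact Finset.sum_comm
  set T : Set (Fin K → ℝ) := {q | q ∈ stdSimplex ℝ (Fin K) ∧ ∀ i, B.a i ∈ S → q i = 0}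
  have hTconv : Convex ℝ T := by
    intro f hf g hg s t hs ht hst
    refine ⟨convex_stdSimplex ℝ _ hf.1 hg.1 hs ht hst, fun i hi => ?_⟩
    simp [hf.2 i hi, hg.2 i hi]
  have hsub : B.LMOp p μ ⊆ T := by
    refine convexHull_min ?_ hTconv
    rintro r ⟨hr, f, hf, hmax⟩
    refine ⟨hr, fun i hi => ?_⟩
    have hfP := hclarke hf
    -- Otherwise the outside coordinates sum to at most `|O(S)| * ε * M ≤ m(S) / 4`, while `ε ≤ 1 /
    -- 2` makes that sum at least `m(S) / 2`.
    obtain ⟨j, hjf⟩ : ∃ j, ε * M < f j := by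
      by_contra hcon
      push Not at hcon
      have h1 : ∑ j with B.a j ∉ S, f j ≤
          ∑ _j ∈ Finset.univ.filter (fun j => B.a j ∉ S), ε * M :=
        Finset.sum_le_sum fun j _ => hcon j
      rw [Finset.sum_const, nsmul_eq_mul, hcard'] at h1
      have h2 : (Nat.card (B.Outside S) : ℝ) * (ε * M) ≤ B.mconst S / 4 := by
        calc (Nat.card (B.Outside S) : ℝ) * (ε * M)
            ≤ Nat.card (B.Outside S) * (B.mconst S / (4 * (Nat.card (B.Outside S) : ℝ))) := by
              gcongr
          _ = _ := by field_simp
      have h3 := hfP.2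
      nlinarith
    exact eq_zero_of_forall_sum_mul_le hr hmax ((hfP.1 i hi).trans_lt hjf)
  have hqT := hsub hq
  obtain ⟨j, hj⟩ := exists_pos_of_mem_stdSimplex hqT.1
  exact ⟨j, fun h => hj.ne' (hqT.2 j h), hj⟩

/-- Where the active arms have full span, the oracle maximizes the gradient. -/
theorem isMax_of_mem_LMOp {p : Fin K → ℝ} {μ : B.Scenario → ℝ}
    (hp : p ∈ stdSimplex ℝ (Fin K)) (hS : B.activeSpan p = B.fullSpan)
    {q : Fin K → ℝ} (hq : q ∈ B.LMOp p μ) :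
    q ∈ stdSimplex ℝ (Fin K) ∧ ∀ q' ∈ stdSimplex ℝ (Fin K),
      ∑ i, q' i * B.mixRate μ (B.minimizer p) i ≤ ∑ i, q i * B.mixRate μ (B.minimizer p) i := by
  obtain ⟨M, hM⟩ := B.exists_isGradientBound
  -- Uniqueness of minimizers at full span leaves a single gradient in the Clarke hull.
  have hclarke : B.clarkeP p μ ⊆ {B.mixRate μ (B.minimizer p)} := by
    refine (B.clarkeP_subset hM).trans (convexHull_min ?_ (convex_singleton _))
    rintro _ ⟨y, hy, -, rfl⟩
    have : y = B.minimizer p := funext fun x =>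
      IsBoundedMinimizer.unique B hp.1 hS (B.minimizer_spec hp.1 x) (hy x)
    rw [this]
    rfl
  set f := B.mixRate μ (B.minimizer p)
  set T : Set (Fin K → ℝ) := {q | q ∈ stdSimplex ℝ (Fin K) ∧ ∀ q' ∈ stdSimplex ℝ (Fin K),
    ∑ i, q' i * f i ≤ ∑ i, q i * f i}
  have hTconv : Convex ℝ T := by
    intro g hg h hh s t hs ht hst
    refine ⟨convex_stdSimplex ℝ _ hg.1 hh.1 hs ht hst, fun q' hq' => ?_⟩
    have h1 := hg.2 q' hq'
    have h2 := hh.2 q' hq'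
    simp only [Pi.add_apply, Pi.smul_apply, smul_eq_mul, add_mul, mul_assoc,
      Finset.sum_add_distrib, ← Finset.mul_sum]
    calc ∑ i, q' i * f i = s * ∑ i, q' i * f i + t * ∑ i, q' i * f i := by
          rw [← add_mul, hst, one_mul]
      _ ≤ _ := by gcongr
  refine (convexHull_min ?_ hTconv : B.LMOp p μ ⊆ T) hq
  rintro r ⟨hr, g, hg, hmax⟩
  rw [mem_singleton_iff.1 (hclarke hg)] at hmax
  exact ⟨hr, hmax⟩

theorem LMOp_subset_stdSimplex (p : Fin K → ℝ) (μ : B.Scenario → ℝ) :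
    B.LMOp p μ ⊆ stdSimplex ℝ (Fin K) :=
  convexHull_min (fun _ h => h.1) (convex_stdSimplex ℝ _)

namespace IsSolution

variable {B} {p : ℝ → Fin K → ℝ} {μ : ℝ → B.Scenario → ℝ}

theorem ac_p' (h : B.IsSolution p μ)
    {s t : ℝ} (hs : 0 ≤ s) (hst : s ≤ t) : AbsolutelyContinuousOnInterval p s t := by
  refine (h.ac_p (t + 1) (by linarith)).mono ?_
  rw [uIcc_of_le hst, uIcc_of_le (by linarith)]
  exact Icc_subset_Icc hs (by linarith)

theorem ac_mu' (h : B.IsSolution p μ)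
    {s t : ℝ} (hs : 0 ≤ s) (hst : s ≤ t) : AbsolutelyContinuousOnInterval μ s t := by
  refine (h.ac_mu (t + 1) (by linarith)).mono ?_
  rw [uIcc_of_le hst, uIcc_of_le (by linarith)]
  exact Icc_subset_Icc hs (by linarith)

theorem inclusion' (h : B.IsSolution p μ)
    : ∀ᵐ t : ℝ, 0 < t → ∃ q ∈ B.LMOp (p t) (μ t), ∃ ν ∈ B.LMOmu (p t) (μ t),
    HasDerivAt p (q - p t) t ∧ HasDerivAt μ (ν - μ t) t :=
  (ae_restrict_iff' measurableSet_Ioi).1 h.inclusion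

/-- The oracle's proposal is nonnegative, so no weight decays faster than `exp (-t)`; in particular
active arms stay active. -/
theorem exp_mul_p_le (h : B.IsSolution p μ) {s t : ℝ} (hs : 0 ≤ s) (hst : s ≤ t) (i : Fin K) :
    Real.exp s * p s i ≤ Real.exp t * p t i := by
  refine ((h.ac_p' hs hst).apply i).exp_mul_le_exp_mul hst ?_
  filter_upwards [h.inclusion'] with r hr hmem
  obtain ⟨q, hq, ν, -, hd, -⟩ := hr (hs.trans_lt hmem.1)
  exact ⟨q i, (B.LMOp_subset_stdSimplex _ _ hq).1 i, hasDerivAt_pi.1 hd i⟩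

/-- While some scenario carries zero information, the oracle gives no mass to the informative `x`,
so `μ_x' = -μ_x`. -/
theorem exp_mul_mu_le (h : B.IsSolution p μ) {s t : ℝ} (hs : 0 ≤ s) (hst : s ≤ t) {x : B.Scenario}
    (hx : ∀ r ∈ Ioo s t, B.D (p r) x ≠ 0 ∧ ∃ z, B.D (p r) z = 0) :
    Real.exp t * μ t x ≤ Real.exp s * μ s x := by
  have := ((h.ac_mu' hs hst).apply x).fun_neg.exp_mul_le_exp_mul hst ?_
  · simpa using this
  filter_upwards [h.inclusion'] with r hr hmem
  obtain ⟨q, -, ν, hν, -, hd⟩ := hr (hs.trans_lt hmem.1)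
  obtain ⟨hx1, z, hz⟩ := hx r hmem
  have h0 := B.eq_zero_of_mem_LMOmu (h.mem_p r (hs.trans hmem.1.le)).1 hν hz hx1
  refine ⟨0, le_rfl, ?_⟩
  have := (hasDerivAt_pi.1 hd x).fun_neg
  rwa [Pi.sub_apply, h0, show -(0 - μ r x) = 0 - -μ r x by ring] at this

theorem p_pos_of_le (h : B.IsSolution p μ)
    {s t : ℝ} (hs : 0 ≤ s) (hst : s ≤ t) {i : Fin K} (hi : 0 < p s i) :
    0 < p t i := by
  have h1 := h.exp_mul_p_le hs hst i
  have h2 : 0 < Real.exp s * p s i := by positivity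
  exact (mul_pos_iff_of_pos_left (Real.exp_pos t)).1 (h2.trans_le h1)

theorem activeSpan_mono (h : B.IsSolution p μ) {s t : ℝ} (hs : 0 ≤ s) (hst : s ≤ t) :
    B.activeSpan (p s) ≤ B.activeSpan (p t) :=
  B.activeSpan_mono fun _ hi => h.p_pos_of_le hs hst hi

theorem exists_D_eq_zero (h : B.IsSolution p μ)
    {t : ℝ} (ht : 0 ≤ t) (hS : B.activeSpan (p t) ≠ B.fullSpan) :
    ∃ x, B.D (p t) x = 0 := by
  by_contra hcon
  push Not at hcon
  exact hS ((B.zeroInfo_eq_empty_iff (h.mem_p t ht)).1 (eq_empty_iff_forall_notMem.2 hcon))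

/-- The active span cannot stay at a proper subspace `S` for longer than `timeS M S`. -/
theorem sub_le_timeS (h : B.IsSolution p μ) {M : ℝ} (hM : B.IsGradientBound M)
    {S : Submodule ℝ (EuclideanSpace ℝ (Fin d))} (hS : S < B.fullSpan) {s t : ℝ} (hs : 0 ≤ s)
    (hst : s < t) (hconst : ∀ r ∈ Ioo s t, B.activeSpan (p r) = S) : t - s ≤ B.timeS M S := by
  have hD0 : ∀ r ∈ Ioo s t, ∃ x, B.D (p r) x = 0 := fun r hr =>
    h.exists_D_eq_zero (hs.trans hr.1.le) (by rw [hconst r hr]; exact hS.ne)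
  have hDiff : ∀ r ∈ Ioo s t, ∀ x, B.D (p r) x = 0 ↔ B.delta x ∉ S := by
    intro r hr x
    rw [B.D_eq_zero_iff (h.mem_p r (hs.trans hr.1.le)).1, hconst r hr]
  obtain ⟨x₀, hx₀⟩ := hD0 ((s + t) / 2) ⟨by linarith, by linarith⟩
  have hε := B.epsS_pos hM hS ((hDiff _ ⟨by linarith, by linarith⟩ x₀).1 hx₀)
  have hT0 : 0 ≤ B.timeS M S := by
    refine Real.log_nonneg ?_
    rw [le_div_iff₀ hε]
    linarith [B.epsS_le_half (S := S) M]
  by_contra hlt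
  push Not at hlt
  -- At a time later than `s + T_S` the informative scenarios have mass at most `exp (s - r) ≤ ε_S`.
  obtain ⟨r, hr, hincl⟩ := exists_mem_Ioo_of_ae h.inclusion'
    (show s + B.timeS M S < t by linarith)
  have hrs : r ∈ Ioo s t := ⟨by linarith [hr.1], hr.2⟩
  have hr0 : 0 < r := hs.trans_lt hrs.1
  obtain ⟨q, hq, -, -, hd, -⟩ := hincl hr0
  have hsub := hconst r hrs
  have hsmall : ∑ x, (if B.D (p r) x = 0 then 0 else μ r x) ≤ B.epsS M S := by
    have hexp : Real.exp (s - r) ≤ B.epsS M S := by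
      calc Real.exp (s - r) ≤ Real.exp (-B.timeS M S) := by
            apply Real.exp_le_exp.2; linarith [hr.1]
        _ = B.epsS M S := by
            rw [timeS, Real.log_div one_ne_zero hε.ne', Real.log_one, zero_sub, neg_neg,
              Real.exp_log hε]
    refine le_trans ?_ hexp
    calc ∑ x, (if B.D (p r) x = 0 then 0 else μ r x) ≤ ∑ x, Real.exp (s - r) * μ s x := by
          refine Finset.sum_le_sum fun x _ => ?_
          have hμ0 := (h.mem_mu s hs).1 x
          split_ifs with hx
          · positivity
          · have h1 := h.exp_mul_mu_le hs hrs.1.le (x := x) fun w hw => by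
              have hw' : w ∈ Ioo s t := ⟨hw.1, hw.2.trans hrs.2⟩
              refine ⟨?_, hD0 w hw'⟩
              rw [Ne, hDiff w hw', ← hDiff r hrs]
              exact hx
            rw [Real.exp_sub, div_mul_eq_mul_div, le_div_iff₀ (Real.exp_pos r)]
            linarith
      _ = Real.exp (s - r) := by rw [← Finset.mul_sum, (h.mem_mu s hs).2, mul_one]
  obtain ⟨j, hjS, hj⟩ := B.exists_pos_outside_of_mem_LMOp (h.mem_p r hr0.le) (h.mem_mu r hr0.le) hM
    (by rw [hsub]; exact hS) (by rw [hsub]; exact hsmall) hq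
  rw [hsub] at hjS
  -- An arm outside `S` has weight zero on the whole interval, hence zero derivative at `r`, whereas
  -- the inclusion gives the derivative `q j > 0`.
  have hzero : ∀ w ∈ Ioo s t, p w j = 0 := by
    intro w hw
    by_contra hne
    have hpos := ((h.mem_p w (hs.trans hw.1.le)).1 j).lt_of_ne' hne
    exact hjS (hconst w hw ▸ B.a_mem_activeSpan hpos)
  have hd1 := hasDerivAt_pi.1 hd j
  have hd2 : HasDerivAt (fun w => p w j) 0 r := by
    refine (hasDerivAt_const r (0 : ℝ)).congr_of_eventuallyEq ?_
    filter_upwards [Ioo_mem_nhds hrs.1 hrs.2] with w hw using hzero w hw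
  have := hd1.unique hd2
  rw [Pi.sub_apply, hzero r hrs, sub_zero] at this
  exact hj.ne' this

end IsSolution


end

end LinearBandit

/-! ### Successive values of a monotone left-continuous function -/

section Chain

variable {α : Type*} [PartialOrder α] {A : ℝ → α} {H : α}

/-- Right after each time, an increasing function with values in a well-founded order is
constant. -/
theorem exists_const_right [WellFoundedLT α] (hmono : ∀ s t, 0 ≤ s → s ≤ t → A s ≤ A t) {s : ℝ}
    (hs : 0 ≤ s) : ∃ S, ∃ t > s, ∀ r ∈ Ioc s t, A r = S := by
  obtain ⟨S, ⟨t, ht, rfl⟩, hmin⟩ := WellFounded.has_min (wellFounded_lt (α := α)) (A '' Ioi s)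
    ⟨_, s + 1, by simp, rfl⟩
  refine ⟨A t, t, ht, fun r hr => ?_⟩
  by_contra hne
  exact hmin (A r) ⟨r, hr.1, rfl⟩ ((hmono r t (hs.trans hr.1.le) hr.2).lt_of_ne hne)

/-- Induction on the current value `S`, from larger values to smaller. The set of times at which `S`
persists is bounded by `hbdd`; right after its supremum the function is constant with a strictly
larger value, from which the remaining chain starts. -/
theorem exists_chain_of_const_right [WellFoundedGT α] [WellFoundedLT α]
    (hmono : ∀ s t, 0 ≤ s → s ≤ t → A s ≤ A t) (hle : ∀ t, 0 ≤ t → A t ≤ H)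
    (hleft : ∀ t, 0 < t → ∃ s, 0 ≤ s ∧ s < t ∧ A s = A t)
    (hbdd : ∀ S < H, ∃ C : ℝ, ∀ s t, 0 ≤ s → s < t → (∀ r ∈ Ioo s t, A r = S) → t - s ≤ C)
    (S : α) : ∀ s : ℝ, 0 ≤ s → (∃ t > s, ∀ r ∈ Ioc s t, A r = S) →
      ∃ (n : ℕ) (σ : ℕ → α) (τ : ℕ → ℝ), σ 0 = S ∧ (∀ l < n, σ l < σ (l + 1)) ∧ σ n = H ∧
        (∀ l < n, ∃ t, 0 ≤ t ∧ A t = σ l) ∧ (∀ l < n, σ l < H) ∧ τ 0 = s ∧ s ≤ τ 1 ∧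
        (∀ l < n, τ l < τ (l + 1)) ∧ (∀ l < n, ∀ t ∈ Ioc (τ l) (τ (l + 1)), A t = σ l) ∧
        (∀ t, τ n < t → A t = H) := by
  induction S using WellFoundedGT.induction with
  | ind S ih =>
    intro s hs ⟨t₀, ht₀, hconst⟩
    have hAt₀ : A t₀ = S := hconst t₀ ⟨ht₀, le_rfl⟩
    have hAge : ∀ r, s < r → S ≤ A r := by
      intro r hr
      rcases le_total r t₀ with hle' | hle'
      · exact (hconst r ⟨hr, hle'⟩).ge
      · exact hAt₀ ▸ hmono t₀ r (hs.trans ht₀.le) hle'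
    by_cases hSH : S = H
    · refine ⟨0, fun _ => S, fun _ => s, rfl, by simp, hSH, by simp, by simp, rfl, le_rfl,
        by simp, by simp, fun t ht => ?_⟩
      exact le_antisymm (hle t (hs.trans ht.le)) (hSH ▸ hAge t ht)
    have hlt : S < H := (hAt₀ ▸ hle t₀ (hs.trans ht₀.le)).lt_of_ne hSH
    obtain ⟨C, hC⟩ := hbdd S hlt
    set J : Set ℝ := {t | s < t ∧ A t = S} with hJ
    have hbetween : ∀ t ∈ J, ∀ r ∈ Ioc s t, A r = S := fun t ht r hr =>
      le_antisymm (ht.2 ▸ hmono r t (hs.trans hr.1.le) hr.2) (hAge r hr.1)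
    have hJne : J.Nonempty := ⟨t₀, ht₀, hAt₀⟩
    have hJbdd : BddAbove J := by
      refine ⟨s + C, fun t ht => ?_⟩
      have := hC s t hs ht.1 fun r hr => hbetween t ht r ⟨hr.1, hr.2.le⟩
      linarith
    set t₁ := sSup J with ht₁
    have hst₁ : s < t₁ := ht₀.trans_le (le_csSup hJbdd ⟨ht₀, hAt₀⟩)
    -- Left continuity shows that the supremum is attained, so epochs are closed on the right.
    have ht₁J : t₁ ∈ J := by
      obtain ⟨w, hw0, hw, hAw⟩ := hleft t₁ (hs.trans_lt hst₁)
      obtain ⟨t, ht, hwt⟩ := exists_lt_of_lt_csSup hJne hw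
      have h1 : A t₁ ≤ A t := hAw ▸ hmono w t hw0 hwt.le
      exact ⟨hst₁, le_antisymm (ht.2 ▸ h1) (hAge t₁ hst₁)⟩
    obtain ⟨S', t', ht', hconst'⟩ := exists_const_right hmono (hs.trans hst₁.le)
    have hSS' : S < S' := by
      have h1 : A t' = S' := hconst' t' ⟨ht', le_rfl⟩
      refine lt_of_le_of_ne (h1 ▸ hAge t' (hst₁.trans ht')) fun heq => ?_
      exact (le_csSup hJbdd (show t' ∈ J from ⟨hst₁.trans ht', h1.trans heq.symm⟩)).not_gt ht'
    obtain ⟨n, σ, τ, h1, h2, h3, h4, h5, h6, -, h8, h9, h10⟩ :=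
      ih S' hSS' t₁ (hs.trans hst₁.le) ⟨t', ht', hconst'⟩
    refine ⟨n + 1, fun k => Nat.casesOn k S σ, fun k => Nat.casesOn k s τ, rfl, ?_, h3, ?_, ?_,
      rfl, ?_, ?_, ?_, h10⟩
    · rintro (_ | l) hl
      · exact hSS'.trans_eq h1.symm
      · exact h2 l (by lia)
    · rintro (_ | l) hl
      · exact ⟨t₁, hs.trans hst₁.le, ht₁J.2⟩
      · exact h4 l (by lia)
    · rintro (_ | l) hl
      · exact hlt
      · exact h5 l (by lia)
    · exact hst₁.le.trans_eq h6.symm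
    · rintro (_ | l) hl
      · exact hst₁.trans_eq h6.symm
      · exact h8 l (by lia)
    · rintro (_ | l) hl
      · intro t ht
        exact hbetween t₁ ht₁J t ⟨ht.1, ht.2.trans_eq h6⟩
      · exact h9 l (by lia)

/-- The successive values of an increasing left-continuous function with values in a well-founded
order. -/
theorem exists_chain [WellFoundedGT α] [WellFoundedLT α]
    (hmono : ∀ s t, 0 ≤ s → s ≤ t → A s ≤ A t) (hle : ∀ t, 0 ≤ t → A t ≤ H)
    (hleft : ∀ t, 0 < t → ∃ s, 0 ≤ s ∧ s < t ∧ A s = A t)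
    (hbdd : ∀ S < H, ∃ C : ℝ, ∀ s t, 0 ≤ s → s < t → (∀ r ∈ Ioo s t, A r = S) → t - s ≤ C) :
    ∃ (n : ℕ) (σ : ℕ → α) (τ : ℕ → ℝ), σ 0 = A 0 ∧ (∀ l < n, σ l < σ (l + 1)) ∧ σ n = H ∧
      (∀ l < n, ∃ t, 0 ≤ t ∧ A t = σ l) ∧ (∀ l < n, σ l < H) ∧ τ 0 = 0 ∧ 0 ≤ τ 1 ∧
      (∀ l, 1 ≤ l → l < n → τ l < τ (l + 1)) ∧
      (∀ l < n, ∀ t ∈ Ioc (τ l) (τ (l + 1)), A t = σ l) ∧ (∀ t, τ n < t → A t = H) := by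
  obtain ⟨S, t₀, ht₀, hconst⟩ := exists_const_right hmono (le_refl (0 : ℝ))
  obtain ⟨n, σ, τ, h1, h2, h3, h4, h5, h6, h7, h8, h9, h10⟩ :=
    exists_chain_of_const_right hmono hle hleft hbdd S 0 le_rfl ⟨t₀, ht₀, hconst⟩
  have hS : A 0 ≤ S := hconst t₀ ⟨ht₀, le_rfl⟩ ▸ hmono 0 t₀ le_rfl (le_of_lt ht₀)
  rcases hS.eq_or_lt with heq | hlt
  · exact ⟨n, σ, τ, h1.trans heq.symm, h2, h3, h4, h5, h6, h7, fun l _ hl => h8 l hl, h9, h10⟩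
  -- If the value jumps immediately after time zero, the initial value gets an empty epoch with `τ 0
  -- = τ 1 = 0`; this is why only `0 ≤ τ 1` is claimed.
  · refine ⟨n + 1, fun k => Nat.casesOn k (A 0) σ, fun k => Nat.casesOn k 0 τ, rfl, ?_, h3, ?_, ?_,
      rfl, h6.ge, ?_, ?_, h10⟩
    · rintro (_ | l) hl
      · exact hlt.trans_eq h1.symm
      · exact h2 l (by lia)
    · rintro (_ | l) hl
      · exact ⟨0, le_rfl, rfl⟩
      · exact h4 l (by lia)
    · rintro (_ | l) hl
      · exact hlt.trans_le (hconst t₀ ⟨ht₀, le_rfl⟩ ▸ hle t₀ (le_of_lt ht₀))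
      · exact h5 l (by lia)
    · rintro (_ | l) h1l hl
      · lia
      · exact h8 l (by lia)
    · rintro (_ | l) hl
      · intro t ht
        exact absurd (ht.1.trans_le (ht.2.trans_eq h6)) (lt_irrefl _)
      · exact h9 l (by lia)

end Chain

/-! ### Epochs of a solution -/

namespace LinearBandit

noncomputable section

variable {K d : ℕ} (B : LinearBandit K d)

theorem timeS_nonneg {p : Fin K → ℝ} (hp : p ∈ stdSimplex ℝ (Fin K)) {M : ℝ}
    (hM : B.IsGradientBound M) (hS : B.activeSpan p < B.fullSpan) :
    0 ≤ B.timeS M (B.activeSpan p) := by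
  obtain ⟨x, hx⟩ : ∃ x, B.D p x = 0 := by
    by_contra h
    push Not at h
    exact hS.ne ((B.zeroInfo_eq_empty_iff hp).1 (eq_empty_iff_forall_notMem.2 h))
  have hε := B.epsS_pos hM hS ((B.D_eq_zero_iff hp.1 x).1 hx)
  refine Real.log_nonneg ?_
  rw [le_div_iff₀ hε]
  linarith [B.epsS_le_half (S := B.activeSpan p) M]

/-- One active feature and the `δ_x` generate everything, so the codimension of the initial span,
and with it the chain length, is at most the rank of the `δ_x`. -/
theorem finrank_fullSpan_le {p : Fin K → ℝ} (hp : p ∈ stdSimplex ℝ (Fin K)) :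
    Module.finrank ℝ B.fullSpan ≤ Module.finrank ℝ (B.activeSpan p) +
      Module.finrank ℝ (Submodule.span ℝ (Set.range B.delta)) := by
  obtain ⟨i, hi⟩ := exists_pos_of_mem_stdSimplex hp
  have hle : B.fullSpan ≤ B.activeSpan p ⊔ Submodule.span ℝ (Set.range B.delta) := by
    refine Submodule.span_le.2 ?_
    rintro _ ⟨j, rfl⟩
    exact B.a_mem_of_delta_mem (Submodule.mem_sup_left (B.a_mem_activeSpan hi))
      (fun x => Submodule.mem_sup_right (Submodule.subset_span (mem_range_self x))) j
  exact (Submodule.finrank_mono hle).trans (Submodule.finrank_add_le_finrank_add_finrank _ _)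

theorem finrank_span_delta_le :
    Module.finrank ℝ (Submodule.span ℝ (Set.range B.delta)) ≤ Module.finrank ℝ B.fullSpan := by
  refine Submodule.finrank_mono (Submodule.span_le.2 ?_)
  rintro _ ⟨x, rfl⟩
  exact sub_mem (B.a_mem_fullSpan _) (B.a_mem_fullSpan _)

/-- An active span depends only on the set of active arms, and there are finitely many such sets. -/
theorem exists_bound_timeS (M : ℝ) : ∃ C : ℝ, 0 ≤ C ∧ ∀ p : Fin K → ℝ,
    B.timeS M (B.activeSpan p) + Real.log 2 ≤ C := by
  obtain ⟨C, hC⟩ := (Set.finite_range fun s : Set (Fin K) =>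
    B.timeS M (Submodule.span ℝ (B.a '' s)) + Real.log 2).bddAbove
  refine ⟨max C 0, le_max_right _ _, fun p => le_trans (hC ?_) (le_max_left _ _)⟩
  exact mem_range_self (f := fun s : Set (Fin K) =>
    B.timeS M (Submodule.span ℝ (B.a '' s)) + Real.log 2) {i | 0 < p i}

theorem add_le_finrank {n : ℕ} {σ : ℕ → Submodule ℝ (EuclideanSpace ℝ (Fin d))}
    (h : ∀ l < n, σ l < σ (l + 1)) :
    Module.finrank ℝ (σ 0) + n ≤ Module.finrank ℝ (σ n) := by
  induction n with
  | zero => simp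
  | succ n ih =>
    have h1 := ih fun l hl => h l (by lia)
    have h2 := Submodule.finrank_lt_finrank_of_lt (h n (by lia))
    omega

namespace IsSolution

variable {B} {p : ℝ → Fin K → ℝ} {μ : ℝ → B.Scenario → ℝ}

/-- By continuity, arms active at `t` are active shortly before; monotonicity gives the other
inclusion. -/
theorem exists_activeSpan_eq_left (h : B.IsSolution p μ) {t : ℝ} (ht : 0 < t) :
    ∃ s, 0 ≤ s ∧ s < t ∧ B.activeSpan (p s) = B.activeSpan (p t) := by
  have hcont : ContinuousWithinAt p (Ioo 0 t) t := by
    have := (h.ac_p t ht).continuousOn t (by simp)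
    refine this.mono ?_
    rw [uIcc_of_le ht.le]
    exact Ioo_subset_Icc_self
  have hev : ∀ᶠ s in 𝓝[Ioo 0 t] t, ∀ i, 0 < p t i → 0 < p s i := by
    rw [eventually_all]
    intro i
    by_cases hi : 0 < p t i
    · filter_upwards [(tendsto_pi_nhds.1 hcont i).eventually (lt_mem_nhds hi)] with s hs _ using hs
    · exact Eventually.of_forall fun s h => absurd h hi
  have hne : (𝓝[Ioo 0 t] t).NeBot := right_nhdsWithin_Ioo_neBot ht
  obtain ⟨s, hs, hmem⟩ := (hev.and self_mem_nhdsWithin).exists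
  exact ⟨s, hmem.1.le, hmem.2, le_antisymm (h.activeSpan_mono hmem.1.le hmem.2.le)
    (B.activeSpan_mono hs)⟩

/-- The expansion of the active span along a solution. -/
theorem exists_epochs (h : B.IsSolution p μ) {M : ℝ} (hM : B.IsGradientBound M) {C : ℝ}
    (hC0 : 0 ≤ C) (hC : ∀ p : Fin K → ℝ, B.timeS M (B.activeSpan p) + Real.log 2 ≤ C) :
    ∃ (r : ℕ) (S : ℕ → Submodule ℝ (EuclideanSpace ℝ (Fin d))) (τ : ℕ → ℝ),
      S 0 = B.activeSpan (p 0) ∧ (∀ l < r, S l < S (l + 1)) ∧ S r = B.fullSpan ∧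
      r ≤ Module.finrank ℝ (Submodule.span ℝ (Set.range B.delta)) ∧
      Module.finrank ℝ (Submodule.span ℝ (Set.range B.delta)) ≤
        Module.finrank ℝ B.fullSpan ∧
      (r = 0 ↔ B.zeroInfo (p 0) = ∅) ∧
      τ 0 = 0 ∧ 0 ≤ τ 1 ∧ (∀ l, 1 ≤ l → l < r → τ l < τ (l + 1)) ∧
      (∀ l < r, ∀ t ∈ Set.Ioc (τ l) (τ (l + 1)),
        B.activeSpan (p t) = S l ∧ (B.zeroInfo (p t)).Nonempty) ∧
      (∀ t, τ r < t → B.activeSpan (p t) = B.fullSpan) ∧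
      (∀ l < r, τ (l + 1) - τ l ≤ B.timeS M (S l) + Real.log 2) ∧
      B.timeStar M r S ≤ Module.finrank ℝ B.fullSpan * C ∧
      (∀ t, B.timeStar M r S ≤ t →
        B.activeSpan (p t) = B.fullSpan ∧ B.zeroInfo (p t) = ∅ ∧
        (∀ x, 0 < B.D (p t) x) ∧ (p t, μ t) ∈ B.diffSet) := by
  obtain ⟨r, S, τ, h1, h2, h3, h4, h5, h6, h7, h8, h9, h10⟩ :=
    exists_chain (A := fun t => B.activeSpan (p t)) (H := B.fullSpan)
      (fun s t hs hst => h.activeSpan_mono hs hst) (fun t _ => B.activeSpan_le_fullSpan _)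
      (fun t ht => h.exists_activeSpan_eq_left ht)
      (fun S hS => ⟨B.timeS M S, fun s t hs hst hr => h.sub_le_timeS hM hS hs hst hr⟩)
  have hlog : 0 < Real.log 2 := Real.log_pos (by norm_num)
  have hrank : r ≤ Module.finrank ℝ (Submodule.span ℝ (Set.range B.delta)) := by
    have e1 := add_le_finrank h2
    have e2 := B.finrank_fullSpan_le (h.mem_p 0 le_rfl)
    rw [h1, h3] at e1
    omega
  have hτ0 : ∀ l, l ≤ r → 0 ≤ τ l := by
    intro l
    induction l with
    | zero => intro _; exact h6.ge
    | succ l ih =>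
      intro hl
      rcases Nat.eq_zero_or_pos l with rfl | hl0
      · exact h7
      · exact (ih (by lia)).trans (h8 l hl0 (by lia)).le
  have hgap : ∀ l < r, τ (l + 1) - τ l ≤ B.timeS M (S l) := by
    intro l hl
    rcases lt_or_ge (τ l) (τ (l + 1)) with hlt | hge
    · exact h.sub_le_timeS hM (h5 l hl) (hτ0 l hl.le) hlt fun w hw => h9 l hl w ⟨hw.1, hw.2.le⟩
    -- For an empty epoch it remains to see that `T_S` is nonnegative, which holds as `S l` is an
    -- actual active span.
    · obtain ⟨t, ht0, ht⟩ := h4 l hl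
      have h11 := h5 l hl
      rw [← ht] at h11 ⊢
      have := B.timeS_nonneg (h.mem_p t ht0) hM h11
      linarith
  have hr0 : r = 0 ↔ B.activeSpan (p 0) = B.fullSpan := by
    constructor
    · rintro rfl
      rw [← h1, h3]
    · intro hfull
      by_contra hne
      have := h5 0 (Nat.pos_of_ne_zero hne)
      rw [h1, hfull] at this
      exact lt_irrefl _ this
  have hτsum : ∀ n ≤ r, τ n ≤ ∑ l ∈ Finset.range n, B.timeS M (S l) := by
    intro n
    induction n with
    | zero => intro _; simp [h6]
    | succ n ih =>
      intro hn
      rw [Finset.sum_range_succ]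
      linarith [ih (by lia), hgap n (by lia)]
  have hstar : B.timeStar M r S = ∑ l ∈ Finset.range r, B.timeS M (S l) + r * Real.log 2 := by
    rw [timeStar, Finset.sum_add_distrib]
    simp
  have hfinal : ∀ t, B.timeStar M r S ≤ t → 0 ≤ t ∧ B.activeSpan (p t) = B.fullSpan := by
    intro t ht
    rcases Nat.eq_zero_or_pos r with hz | hpos
    · rw [hz] at ht
      simp only [timeStar, Finset.range_zero, Finset.sum_empty] at ht
      refine ⟨ht, le_antisymm (B.activeSpan_le_fullSpan _) ?_⟩
      rw [← hr0.1 hz]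
      exact h.activeSpan_mono le_rfl ht
    -- Full span is known only strictly after `τ r`; the extra `log 2` per epoch supplies the strict
    -- inequality.
    · have hlt : τ r < t := by
        have e1 : 0 < (r : ℝ) * Real.log 2 := by positivity
        linarith [hτsum r le_rfl]
      exact ⟨(hτ0 r le_rfl).trans hlt.le, h10 t hlt⟩
  refine ⟨r, S, τ, h1, h2, h3, hrank, B.finrank_span_delta_le, ?_, h6, h7, h8, ?_, h10, ?_, ?_, ?_⟩
  · rw [hr0, B.zeroInfo_eq_empty_iff (h.mem_p 0 le_rfl)]
  · intro l hl t ht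
    have e1 := h9 l hl t ht
    refine ⟨e1, nonempty_iff_ne_empty.2 fun hemp => ?_⟩
    rw [B.zeroInfo_eq_empty_iff (h.mem_p t ((hτ0 l hl.le).trans ht.1.le))] at hemp
    exact (h5 l hl).ne (e1.symm.trans hemp)
  · intro l hl
    linarith [hgap l hl]
  · have e1 : B.timeStar M r S ≤ ∑ _l ∈ Finset.range r, C := by
      refine Finset.sum_le_sum fun l hl => ?_
      obtain ⟨t, -, ht⟩ := h4 l (Finset.mem_range.1 hl)
      rw [← ht]
      exact hC (p t)
    rw [Finset.sum_const, Finset.card_range, nsmul_eq_mul] at e1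
    have e2 : (r : ℝ) ≤ Module.finrank ℝ B.fullSpan := by
      exact_mod_cast hrank.trans B.finrank_span_delta_le
    exact e1.trans (mul_le_mul_of_nonneg_right e2 hC0)
  · intro t ht
    obtain ⟨ht0, hS⟩ := hfinal t ht
    exact ⟨hS, (B.zeroInfo_eq_empty_iff (h.mem_p t ht0)).2 hS,
      B.D_pos_of_activeSpan_eq (h.mem_p t ht0).1 hS,
      B.mem_diffSet_of_activeSpan_eq (h.mem_p t ht0) (h.mem_mu t ht0) hS⟩

end IsSolution


end

end LinearBandit

/-! ### Sums, maxima and minima of absolutely continuous functions -/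

namespace AbsolutelyContinuousOnInterval

variable {ι : Type*} {a b : ℝ}

theorem finset_sum {f : ι → ℝ → ℝ} (s : Finset ι)
    (hf : ∀ i, AbsolutelyContinuousOnInterval (f i) a b) :
    AbsolutelyContinuousOnInterval (fun t => ∑ i ∈ s, f i t) a b := by
  classical
  induction s using Finset.induction_on with
  | empty =>
    simp only [Finset.sum_empty]
    exact (LipschitzWith.const (0 : ℝ)).lipschitzOnWith.absolutelyContinuousOnInterval
  | insert i s hi ih =>
    simp only [Finset.sum_insert hi]
    exact (hf i).fun_add ih

theorem pi [Fintype ι] {f : ℝ → ι → ℝ}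
    (hf : ∀ i, AbsolutelyContinuousOnInterval (fun t => f t i) a b) :
    AbsolutelyContinuousOnInterval f a b := by
  have h := tendsto_finsetSum Finset.univ fun i _ => hf i
  simp only [Finset.sum_const_zero] at h
  refine squeeze_zero' (Eventually.of_forall fun _ => Finset.sum_nonneg fun i hi => dist_nonneg)
    (Eventually.of_forall fun E => ?_) h
  rw [Finset.sum_comm]
  refine Finset.sum_le_sum fun k _ => ?_
  refine (dist_pi_le_iff (Finset.sum_nonneg fun i _ => dist_nonneg)).2 fun i => ?_
  exact Finset.single_le_sum (f := fun i => dist (f (E.2 k).1 i) (f (E.2 k).2 i))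
    (fun _ _ => dist_nonneg) (Finset.mem_univ i)

theorem ciSup [Fintype ι] [Nonempty ι] {f : ℝ → ι → ℝ} (hf : AbsolutelyContinuousOnInterval f a b) :
    AbsolutelyContinuousOnInterval (fun t => ⨆ i, f t i) a b := by
  have key : ∀ u v : ι → ℝ, ⨆ i, u i ≤ (⨆ i, v i) + dist u v := by
    intro u v
    refine ciSup_le fun i => ?_
    have h1 := le_ciSup (Set.finite_range v).bddAbove i
    have h2 := dist_le_pi_dist u v i
    have h3 := le_abs_self (u i - v i)
    rw [Real.dist_eq] at h2
    linarith
  refine hf.of_dist_le (C := 1) fun s _ t _ => ?_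
  rw [one_mul, Real.dist_eq, abs_le]
  have h1 := key (f s) (f t)
  have h2 := key (f t) (f s)
  rw [dist_comm] at h2
  constructor <;> linarith

theorem ciInf [Fintype ι] [Nonempty ι] {f : ℝ → ι → ℝ} (hf : AbsolutelyContinuousOnInterval f a b) :
    AbsolutelyContinuousOnInterval (fun t => ⨅ i, f t i) a b := by
  have key : ∀ u v : ι → ℝ, (⨅ i, u i) - dist u v ≤ ⨅ i, v i := by
    intro u v
    refine le_ciInf fun i => ?_
    have h1 := ciInf_le (Set.finite_range u).bddBelow i
    have h2 := dist_le_pi_dist u v i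
    have h3 := le_abs_self (u i - v i)
    rw [Real.dist_eq] at h2
    linarith
  refine hf.of_dist_le (C := 1) fun s _ t _ => ?_
  rw [one_mul, Real.dist_eq, abs_le]
  have h1 := key (f s) (f t)
  have h2 := key (f t) (f s)
  rw [dist_comm] at h2
  constructor <;> linarith

end AbsolutelyContinuousOnInterval

/-- Two touching functions have the same derivative at the point of contact. -/
theorem HasDerivAt.eq_of_eventually_le {f g : ℝ → ℝ} {f' g' t : ℝ} (hf : HasDerivAt f f' t)
    (hg : HasDerivAt g g' t) (hle : ∀ᶠ s in 𝓝 t, f s ≤ g s) (heq : f t = g t) : f' = g' := by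
  have hmin : IsLocalMin (fun s => g s - f s) t := by
    filter_upwards [hle] with s hs
    simp only [heq, sub_self]
    exact sub_nonneg.2 hs
  have := hmin.hasDerivAt_eq_zero (hg.fun_sub hf)
  linarith

/-! ### Exponential decay of the duality gap -/

namespace LinearBandit

noncomputable section

variable {K d : ℕ} (B : LinearBandit K d)

/-- The largest coordinate of the gradient of `F(·, μ)` at `p`. -/
def upperValue (p : Fin K → ℝ) (μ : B.Scenario → ℝ) : ℝ := ⨆ i, B.mixRate μ (B.minimizer p) i

/-- The smallest information over all scenarios. -/
def lowerValue (p : Fin K → ℝ) : ℝ := ⨅ x, B.D p x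

theorem le_upperValue (p : Fin K → ℝ) (μ : B.Scenario → ℝ) {q : Fin K → ℝ}
    (hq : q ∈ stdSimplex ℝ (Fin K)) :
    ∑ i, q i * B.mixRate μ (B.minimizer p) i ≤ B.upperValue p μ := by
  calc ∑ i, q i * B.mixRate μ (B.minimizer p) i ≤ ∑ i, q i * B.upperValue p μ :=
        Finset.sum_le_sum fun i _ => mul_le_mul_of_nonneg_left
          (le_ciSup (Set.finite_range (B.mixRate μ (B.minimizer p))).bddAbove i) (hq.1 i)
    _ = _ := by rw [← Finset.sum_mul, hq.2, one_mul]

theorem lowerValue_le (p : Fin K → ℝ) {ν : B.Scenario → ℝ}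
    (hν : ν ∈ stdSimplex ℝ B.Scenario) : B.lowerValue p ≤ B.F p ν := by
  calc B.lowerValue p = ∑ x, ν x * B.lowerValue p := by rw [← Finset.sum_mul, hν.2, one_mul]
    _ ≤ _ := Finset.sum_le_sum fun x _ => mul_le_mul_of_nonneg_left
          (ciInf_le (Set.finite_range (B.D p)).bddBelow x) (hν.1 x)

theorem upperValue_eq {p : Fin K → ℝ} {μ : B.Scenario → ℝ} {q : Fin K → ℝ}
    (hq : q ∈ stdSimplex ℝ (Fin K)) (hmax : ∀ q' ∈ stdSimplex ℝ (Fin K),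
      ∑ i, q' i * B.mixRate μ (B.minimizer p) i ≤ ∑ i, q i * B.mixRate μ (B.minimizer p) i) :
    ∑ i, q i * B.mixRate μ (B.minimizer p) i = B.upperValue p μ := by
  have : Nonempty (Fin K) := ⟨B.best⟩
  refine le_antisymm (B.le_upperValue p μ hq) (ciSup_le fun i => ?_)
  simpa [Pi.single_apply] using hmax _ (single_mem_stdSimplex' i)

theorem lowerValue_eq {p : Fin K → ℝ} {μ ν : B.Scenario → ℝ} (hν : ν ∈ B.LMOmu p μ)
    [Nonempty B.Scenario] : B.lowerValue p = B.F p ν :=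
  le_antisymm (B.lowerValue_le p hν.1) (le_ciInf fun x => B.sum_mul_D_le_of_mem_LMOmu hν x)

/-- Monotonicity of the supergradients of a concave function: the sum of the two minimality
inequalities. -/
theorem sum_sub_mul_rate_sub_nonpos {p q : Fin K → ℝ} {x : B.Scenario} {y y' : Fin K → ℝ}
    (hy : B.IsMinimizer p x y) (hy' : B.IsMinimizer q x y') :
    ∑ i, (q i - p i) * (B.rate y' i - B.rate y i) ≤ 0 := by
  have e1 := B.energy_sub_energy q p y'
  have e2 := B.energy_sub_energy q p y
  simp only [mul_sub, Finset.sum_sub_distrib]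
  linarith [hy.2 y' hy'.1, hy'.2 y hy.1]

theorem upperValue_le {p : Fin K → ℝ} (hp : p ∈ orthant K) {μ : B.Scenario → ℝ}
    (hμ : μ ∈ stdSimplex ℝ B.Scenario) :
    B.upperValue p μ ≤ ∑ i, B.radius ^ 2 / (2 * (B.σ i : ℝ) ^ 2) := by
  have : Nonempty (Fin K) := ⟨B.best⟩
  refine ciSup_le fun i => ?_
  calc B.mixRate μ (B.minimizer p) i
      ≤ ∑ x, μ x * ∑ i, B.radius ^ 2 / (2 * (B.σ i : ℝ) ^ 2) :=
        Finset.sum_le_sum fun x _ => mul_le_mul_of_nonneg_left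
          (B.rate_le_sum (B.minimizer_spec hp x).2 i) (hμ.1 x)
    _ = _ := by rw [← Finset.sum_mul, hμ.2, one_mul]

namespace IsSolution

variable {B} {p : ℝ → Fin K → ℝ} {μ : ℝ → B.Scenario → ℝ}

/-- The supergradient inequality between times `t` and `s`, divided by `(s - t) ^ 2`, passes to the
limit. -/
theorem sum_deriv_rate_nonpos (h : B.IsSolution p μ)
    {t : ℝ} (ht : 0 < t) {x : B.Scenario} {p' w' : Fin K → ℝ}
    (hp' : HasDerivAt p p' t)
    (hw' : ∀ i, HasDerivAt (fun s => B.rate (B.minimizer (p s) x) i) (w' i) t) :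
    ∑ i, p' i * w' i ≤ 0 := by
  have hlim : Tendsto (fun s => ∑ i, slope (fun s => p s i) t s *
      slope (fun s => B.rate (B.minimizer (p s) x) i) t s) (𝓝[≠] t) (𝓝 (∑ i, p' i * w' i)) :=
    tendsto_finsetSum _ fun i _ => (hasDerivAt_iff_tendsto_slope.1 (hasDerivAt_pi.1 hp' i)).mul
      (hasDerivAt_iff_tendsto_slope.1 (hw' i))
  refine le_of_tendsto hlim ?_
  filter_upwards [nhdsWithin_le_nhds (lt_mem_nhds ht)] with s hs
  have h1 := B.sum_sub_mul_rate_sub_nonpos (B.minimizer_spec (h.mem_p t ht.le).1 x).1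
    (B.minimizer_spec (h.mem_p s hs.le).1 x).1
  have h2 : ∑ i, slope (fun s => p s i) t s *
      slope (fun s => B.rate (B.minimizer (p s) x) i) t s =
      (s - t)⁻¹ ^ 2 * ∑ i, (p s i - p t i) *
        (B.rate (B.minimizer (p s) x) i - B.rate (B.minimizer (p t) x) i) := by
    rw [Finset.mul_sum]
    refine Finset.sum_congr rfl fun i _ => ?_
    simp only [slope_def_field]
    ring
  rw [h2]
  exact mul_nonpos_of_nonneg_of_nonpos (by positivity) h1

/-- Envelope argument: the energy with the minimizer frozen at time `t` lies above `D` and touches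
it there, so the motion of the minimizer contributes nothing to the derivative. -/
theorem hasDerivAt_D (h : B.IsSolution p μ)
    {t : ℝ} (ht : 0 < t) {x : B.Scenario} {p' w' : Fin K → ℝ}
    (hp' : HasDerivAt p p' t)
    (hw' : ∀ i, HasDerivAt (fun s => B.rate (B.minimizer (p s) x) i) (w' i) t) :
    HasDerivAt (fun s => B.D (p s) x) (∑ i, p' i * B.rate (B.minimizer (p t) x) i) t ∧
      ∑ i, p t i * w' i = 0 := by
  have h1 : HasDerivAt (fun s => ∑ i, p s i * B.rate (B.minimizer (p s) x) i)
      (∑ i, (p' i * B.rate (B.minimizer (p t) x) i + p t i * w' i)) t :=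
    HasDerivAt.fun_sum fun i _ => (hasDerivAt_pi.1 hp' i).fun_mul (hw' i)
  have h2 : HasDerivAt (fun s => B.D (p s) x)
      (∑ i, (p' i * B.rate (B.minimizer (p t) x) i + p t i * w' i)) t := by
    refine h1.congr_of_eventuallyEq ?_
    filter_upwards [lt_mem_nhds ht] with s hs
    exact B.D_eq (h.mem_p s hs.le).1 x
  have h3 : HasDerivAt (fun s => ∑ i, p s i * B.rate (B.minimizer (p t) x) i)
      (∑ i, p' i * B.rate (B.minimizer (p t) x) i) t :=
    HasDerivAt.fun_sum fun i _ => (hasDerivAt_pi.1 hp' i).mul_const _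
  have h4 := h2.eq_of_eventually_le h3 ?_ (B.D_eq (h.mem_p t ht.le).1 x)
  · rw [← h4]
    refine ⟨h2, ?_⟩
    rw [Finset.sum_add_distrib] at h4
    linarith
  · filter_upwards [lt_mem_nhds ht] with s hs
    exact B.D_le_energy (h.mem_p s hs.le).1 (B.minimizer_spec (h.mem_p t ht.le).1 x).1.1

/-- The duality gap decreases at least at unit rate. -/
theorem deriv_gap_le (h : B.IsSolution p μ) [Nonempty B.Scenario] {t : ℝ} (ht : 0 < t)
    (hS : B.activeSpan (p t) = B.fullSpan)
    {q : Fin K → ℝ} (hq : q ∈ B.LMOp (p t) (μ t)) {ν : B.Scenario → ℝ}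
    (hν : ν ∈ B.LMOmu (p t) (μ t)) (hp' : HasDerivAt p (q - p t) t)
    (hμ' : HasDerivAt μ (ν - μ t) t) {w' : B.Scenario → Fin K → ℝ}
    (hw' : ∀ x i, HasDerivAt (fun s => B.rate (B.minimizer (p s) x) i) (w' x i) t) {u' l' : ℝ}
    (hu' : HasDerivAt (fun s => B.upperValue (p s) (μ s)) u' t)
    (hl' : HasDerivAt (fun s => B.lowerValue (p s)) l' t) :
    u' - l' ≤ B.lowerValue (p t) - B.upperValue (p t) (μ t) := by
  obtain ⟨hqS, hmax⟩ := B.isMax_of_mem_LMOp (h.mem_p t ht.le) hS hq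
  set w : B.Scenario → Fin K → ℝ := fun x i => B.rate (B.minimizer (p t) x) i with hw
  have hf' : ∀ i, HasDerivAt (fun s => B.mixRate (μ s) (B.minimizer (p s)) i)
      (∑ x, ((ν x - μ t x) * w x i + μ t x * w' x i)) t := fun i =>
    HasDerivAt.fun_sum fun x _ => (hasDerivAt_pi.1 hμ' x).fun_mul (hw' x i)
  -- With the optimal `q` frozen, the averaged gradient touches `upperValue` from below at `t`.
  have hu : ∑ i, q i * ∑ x, ((ν x - μ t x) * w x i + μ t x * w' x i) = u' := by
    refine HasDerivAt.eq_of_eventually_le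
      (f := fun s => ∑ i, q i * B.mixRate (μ s) (B.minimizer (p s)) i)
      (HasDerivAt.fun_sum fun i _ => (hf' i).const_mul (q i)) hu' ?_ (B.upperValue_eq hqS hmax)
    exact Eventually.of_forall fun s => B.le_upperValue _ _ hqS
  -- With the optimal `ν` frozen, the payoff touches `lowerValue` from above at `t`.
  have hl : l' = ∑ x, ν x * ∑ i, (q i - p t i) * w x i := by
    refine HasDerivAt.eq_of_eventually_le (g := fun s => B.F (p s) ν) hl'
      (HasDerivAt.fun_sum fun x _ => ((h.hasDerivAt_D ht hp' (hw' x)).1).const_mul (ν x)) ?_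
      (B.lowerValue_eq hν)
    exact Eventually.of_forall fun s => B.lowerValue_le _ hν.1
  -- As `p' = q - p` and the `p`-average of `w'` vanishes, concavity bounds the `q`-average alone.
  have hcurv : ∀ x, ∑ i, q i * w' x i ≤ 0 := by
    intro x
    have h1 := h.sum_deriv_rate_nonpos ht hp' (hw' x)
    have h2 := (h.hasDerivAt_D ht hp' (hw' x)).2
    simp only [Pi.sub_apply, sub_mul, Finset.sum_sub_distrib] at h1
    linarith
  have hu2 : u' = ∑ x, ν x * ∑ i, q i * w x i - B.upperValue (p t) (μ t) +
      ∑ x, μ t x * ∑ i, q i * w' x i := by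
    rw [← hu, ← B.upperValue_eq hqS hmax]
    simp only [mixRate, Finset.mul_sum]
    rw [Finset.sum_comm (f := fun (x : B.Scenario) (i : Fin K) => ν x * (q i * w x i)),
      Finset.sum_comm (f := fun (x : B.Scenario) (i : Fin K) => μ t x * (q i * w' x i)),
      ← Finset.sum_sub_distrib, ← Finset.sum_add_distrib]
    refine Finset.sum_congr rfl fun i _ => ?_
    rw [← Finset.sum_sub_distrib, ← Finset.sum_add_distrib]
    refine Finset.sum_congr rfl fun x _ => ?_
    simp only [hw]
    ring
  have hl2 : l' = ∑ x, ν x * ∑ i, q i * w x i - B.lowerValue (p t) := by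
    rw [hl, B.lowerValue_eq hν, F, ← Finset.sum_sub_distrib]
    refine Finset.sum_congr rfl fun x _ => ?_
    rw [B.D_eq (h.mem_p t ht.le).1, energy, ← mul_sub, ← Finset.sum_sub_distrib]
    simp only [hw, sub_mul]
  have h3 : ∑ x, μ t x * ∑ i, q i * w' x i ≤ 0 := Finset.sum_nonpos fun x _ =>
    mul_nonpos_of_nonneg_of_nonpos ((h.mem_mu t ht.le).1 x) (hcurv x)
  linarith

/-- Weights lose at most the factor `exp (a - b)` on the interval, so coercivity at `a` holds
throughout with a common constant and the minimizer is Lipschitz in the weights along the path. -/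
theorem ac_minimizer (h : B.IsSolution p μ) {a b : ℝ} (ha : 0 ≤ a) (hab : a ≤ b)
    (hS : B.activeSpan (p a) = B.fullSpan) (x : B.Scenario) :
    AbsolutelyContinuousOnInterval (fun t => B.minimizer (p t) x) a b := by
  obtain ⟨c, hc, hcoer⟩ := B.exists_coercive (h.mem_p a ha).1 hS
  set c' := Real.exp (a - b) * c with hc'
  have hc'0 : 0 < c' := by positivity
  have hcoer' : ∀ t ∈ Icc a b, ∀ z ∈ LinearMap.range B.response,
      c' * ‖z‖ ^ 2 ≤ B.energy (p t) z := by
    intro t ht z hz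
    have h1 : ∀ i, Real.exp (a - b) * p a i ≤ p t i := by
      intro i
      have e1 := h.exp_mul_p_le ha ht.1 i
      have e2 := (h.mem_p a ha).1 i
      calc Real.exp (a - b) * p a i ≤ Real.exp (a - t) * p a i := by
            gcongr; exact ht.2
        _ ≤ p t i := by
            rw [Real.exp_sub, div_mul_eq_mul_div, div_le_iff₀ (Real.exp_pos t)]; linarith
    calc c' * ‖z‖ ^ 2 = Real.exp (a - b) * (c * ‖z‖ ^ 2) := by rw [hc']; ring
      _ ≤ Real.exp (a - b) * B.energy (p a) z := by
          gcongr; exact hcoer z hz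
      _ = ∑ i, Real.exp (a - b) * p a i * B.rate z i := by
          rw [energy, Finset.mul_sum]
          exact Finset.sum_congr rfl fun i _ => by ring
      _ ≤ _ := Finset.sum_le_sum fun i _ =>
          mul_le_mul_of_nonneg_right (h1 i) (B.rate_nonneg _ _)
  refine (h.ac_p' ha hab).of_dist_le (C := B.lipConst / c') fun s hs t ht => ?_
  rw [uIcc_of_le hab] at hs ht
  have hps := (h.mem_p s (ha.trans hs.1)).1
  have hpt := (h.mem_p t (ha.trans ht.1)).1
  have := B.norm_sub_le_of_isBoundedMinimizer hpt hps (hcoer' t ht) (B.minimizer_spec hpt x)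
    (B.minimizer_spec hps x)
  rw [dist_eq_norm, dist_eq_norm, div_mul_eq_mul_div, le_div_iff₀ hc'0]
  linarith

theorem ac_rate (h : B.IsSolution p μ) {a b : ℝ} (ha : 0 ≤ a) (hab : a ≤ b)
    (hS : B.activeSpan (p a) = B.fullSpan) (x : B.Scenario) (i : Fin K) :
    AbsolutelyContinuousOnInterval (fun t => B.rate (B.minimizer (p t) x) i) a b := by
  have h1 := (h.ac_minimizer ha hab hS x).apply i
  have h2 := (h1.fun_mul h1).const_mul (1 / (2 * (B.σ i : ℝ) ^ 2))
  convert h2 using 2 with t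
  simp only [rate]
  ring

/-- Once the active arms have full span, the duality gap decays exponentially. -/
theorem exp_mul_gap_le (h : B.IsSolution p μ)
    [Nonempty B.Scenario] {a b : ℝ} (ha : 0 ≤ a) (hab : a ≤ b)
    (hS : B.activeSpan (p a) = B.fullSpan) :
    Real.exp b * (B.upperValue (p b) (μ b) - B.lowerValue (p b)) ≤
      Real.exp a * (B.upperValue (p a) (μ a) - B.lowerValue (p a)) := by
  have : Nonempty (Fin K) := ⟨B.best⟩
  have hrate := h.ac_rate ha hab hS
  have hU : AbsolutelyContinuousOnInterval (fun t => B.upperValue (p t) (μ t)) a b := by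
    refine AbsolutelyContinuousOnInterval.ciSup (f := fun t => B.mixRate (μ t) (B.minimizer (p t)))
      (AbsolutelyContinuousOnInterval.pi fun i => ?_)
    exact AbsolutelyContinuousOnInterval.finset_sum _ fun x =>
      ((h.ac_mu' ha hab).apply x).fun_mul (hrate x i)
  have hD : ∀ x, AbsolutelyContinuousOnInterval (fun t => B.D (p t) x) a b := by
    intro x
    have h1 : AbsolutelyContinuousOnInterval
        (fun t => ∑ i, p t i * B.rate (B.minimizer (p t) x) i) a b :=
      AbsolutelyContinuousOnInterval.finset_sum _ fun i =>
        ((h.ac_p' ha hab).apply i).fun_mul (hrate x i)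
    refine h1.of_dist_le (C := 1) fun s hs t ht => ?_
    rw [uIcc_of_le hab] at hs ht
    rw [one_mul, B.D_eq (h.mem_p s (ha.trans hs.1)).1, B.D_eq (h.mem_p t (ha.trans ht.1)).1]
    rfl
  have hL : AbsolutelyContinuousOnInterval (fun t => B.lowerValue (p t)) a b :=
    AbsolutelyContinuousOnInterval.ciInf (f := fun t => B.D (p t))
      (AbsolutelyContinuousOnInterval.pi hD)
  -- The exponential comparison is applied to minus the gap, whose derivative plus itself is
  -- nonnegative.
  have hmain := (hL.fun_sub hU).exp_mul_le_exp_mul hab ?_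
  · linarith
  have hrate_ae : ∀ᵐ t : ℝ, ∀ x i, t ∈ uIcc a b →
      DifferentiableAt ℝ (fun s => B.rate (B.minimizer (p s) x) i) t := by
    rw [ae_all_iff]
    intro x
    rw [ae_all_iff]
    exact fun i => (hrate x i).ae_differentiableAt
  filter_upwards [h.inclusion', hrate_ae, hU.ae_differentiableAt, hL.ae_differentiableAt]
    with t hincl hr hu hl ht
  have ht0 : 0 < t := ha.trans_lt ht.1
  have htI : t ∈ uIcc a b := by
    rw [uIcc_of_le hab]; exact ⟨ht.1.le, ht.2.le⟩
  obtain ⟨q, hq, ν, hν, hp', hμ'⟩ := hincl ht0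
  have hSt : B.activeSpan (p t) = B.fullSpan :=
    le_antisymm (B.activeSpan_le_fullSpan _) (hS ▸ h.activeSpan_mono ha ht.1.le)
  have hu' := (hu htI).hasDerivAt
  have hl' := (hl htI).hasDerivAt
  have hgap := h.deriv_gap_le ht0 hSt hq hν hp' hμ' (fun x i => (hr x i htI).hasDerivAt) hu' hl'
  set u' := deriv (fun t => B.upperValue (p t) (μ t)) t
  set l' := deriv (fun t => B.lowerValue (p t)) t
  refine ⟨l' - u' + (B.lowerValue (p t) - B.upperValue (p t) (μ t)), by linarith, ?_⟩
  rw [add_sub_cancel_right]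
  exact hl'.fun_sub hu'

end IsSolution

/-! ### Nash equilibrium and the game value -/

theorem concaveOn_D (x : B.Scenario) : ConcaveOn ℝ (stdSimplex ℝ (Fin K)) fun p => B.D p x := by
  refine ⟨convex_stdSimplex ℝ _, fun p hp q hq s t hs ht hst => ?_⟩
  have hmem := convex_stdSimplex ℝ _ hp hq hs ht hst
  have hy := (B.minimizer_spec hmem.1 x).1.1
  have e1 := B.D_le_energy hp.1 hy
  have e2 := B.D_le_energy hq.1 hy
  simp only [smul_eq_mul]
  rw [B.D_eq hmem.1]
  have : B.energy (s • p + t • q) (B.minimizer (s • p + t • q) x) =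
      s * B.energy p (B.minimizer (s • p + t • q) x) +
        t * B.energy q (B.minimizer (s • p + t • q) x) := by
    simp only [energy, Finset.mul_sum, ← Finset.sum_add_distrib, Pi.add_apply, Pi.smul_apply,
      smul_eq_mul]
    exact Finset.sum_congr rfl fun i _ => by ring
  rw [this]
  gcongr

/-- Testing with a bounded minimizer at one point bounds `D` at another, which gives a Lipschitz
constant valid up to the boundary. -/
theorem continuousOn_D (x : B.Scenario) : ContinuousOn (fun p => B.D p x) (orthant K) := by
  set C : ℝ := ∑ i, B.radius ^ 2 / (2 * (B.σ i : ℝ) ^ 2) with hC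
  have hC0 : 0 ≤ C := Finset.sum_nonneg fun _ _ => by positivity
  have key : ∀ p ∈ orthant K, ∀ q ∈ orthant K, B.D q x ≤ B.D p x + C * dist q p := by
    intro p hp q hq
    have hy := B.minimizer_spec hp x
    have e1 := B.D_le_energy hq hy.1.1
    have e2 := B.energy_sub_energy q p (B.minimizer p x)
    rw [B.D_eq hp]
    have e3 : ∑ i, (q i - p i) * B.rate (B.minimizer p x) i ≤ C * dist q p := by
      rw [hC, Finset.sum_mul]
      refine Finset.sum_le_sum fun i _ => ?_
      have e4 : q i - p i ≤ dist q p := (le_abs_self _).trans (dist_le_pi_dist q p i)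
      have e5 := B.rate_le_of_norm_le hy.2 i
      have e6 := B.rate_nonneg (B.minimizer p x) i
      calc (q i - p i) * B.rate (B.minimizer p x) i
          ≤ dist q p * B.rate (B.minimizer p x) i := by gcongr
        _ ≤ dist q p * (B.radius ^ 2 / (2 * (B.σ i : ℝ) ^ 2)) := by gcongr
        _ = _ := mul_comm _ _
    linarith
  have hlip : LipschitzOnWith ⟨C, hC0⟩ (fun p => B.D p x) (orthant K) := by
    refine LipschitzOnWith.of_dist_le_mul fun p hp q hq => ?_
    change dist (B.D p x) (B.D q x) ≤ C * dist p q
    rw [Real.dist_eq, abs_le]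
    have e1 := key p hp q hq
    have e2 := key q hq p hp
    rw [dist_comm] at e1
    constructor <;> linarith
  exact hlip.continuousOn

/-- Sion's theorem: the payoff is linear in `μ`, and concave and continuous in `p`, on compact
simplices. -/
theorem exists_isNash [Nonempty B.Scenario] :
    ∃ (p : Fin K → ℝ) (μ : B.Scenario → ℝ), B.IsNash p μ := by
  obtain ⟨x₀⟩ := ‹Nonempty B.Scenario›
  obtain ⟨μ, hμ, p, hp, hsad⟩ := Sion.exists_isSaddlePointOn (X := stdSimplex ℝ B.Scenario)
    (Y := stdSimplex ℝ (Fin K)) (f := fun μ p => B.F p μ)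
    ⟨_, single_mem_stdSimplex' x₀⟩ (convex_stdSimplex ℝ _) (isCompact_stdSimplex ℝ _)
    (fun p _ => ContinuousOn.lowerSemicontinuousOn (by unfold F; fun_prop))
    (fun p _ => ConvexOn.quasiconvexOn ⟨convex_stdSimplex ℝ _, fun μ _ ν _ s t _ _ _ => by
      simp only [F, Finset.mul_sum, smul_eq_mul, Pi.add_apply, Pi.smul_apply,
        ← Finset.sum_add_distrib]
      exact le_of_eq (Finset.sum_congr rfl fun x _ => by ring)⟩)
    (convex_stdSimplex ℝ _) ⟨_, uniform_mem_stdSimplex B.best⟩ (isCompact_stdSimplex ℝ _)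
    (fun μ _ => ContinuousOn.upperSemicontinuousOn (continuousOn_finsetSum _ fun x _ =>
      continuousOn_const.mul ((B.continuousOn_D x).mono fun p hp => hp.1)))
    (fun μ hμ => ConcaveOn.quasiconcaveOn ⟨convex_stdSimplex ℝ _, fun p hp q hq s t hs ht hst => by
      simp only [F, Finset.mul_sum, smul_eq_mul, ← Finset.sum_add_distrib]
      refine Finset.sum_le_sum fun x _ => ?_
      have e1 := (B.concaveOn_D x).2 hp hq hs ht hst
      simp only [smul_eq_mul] at e1
      calc s * (μ x * B.D p x) + t * (μ x * B.D q x)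
          = μ x * (s * B.D p x + t * B.D q x) := by ring
        _ ≤ _ := mul_le_mul_of_nonneg_left e1 (hμ.1 x)⟩)
  exact ⟨p, μ, hp, hμ, fun q hq => hsad μ hμ q hq, fun ν hν => hsad ν hν p hp⟩

/-- Both the current payoff and the game value lie between `lowerValue` and `upperValue`. -/
theorem abs_F_sub_le {p₀ : Fin K → ℝ} {μ₀ : B.Scenario → ℝ} (hN : B.IsNash p₀ μ₀)
    {p : Fin K → ℝ} (hp : p ∈ stdSimplex ℝ (Fin K)) {μ : B.Scenario → ℝ}
    (hμ : μ ∈ stdSimplex ℝ B.Scenario) :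
    |B.F p μ - B.F p₀ μ₀| ≤ B.upperValue p μ - B.lowerValue p := by
  obtain ⟨hp₀, hμ₀, hmax, hmin⟩ := hN
  have hy := fun x => B.minimizer_spec hp.1 x
  have e1 := B.lowerValue_le p hμ
  have e2 : B.F p μ ≤ B.upperValue p μ := (B.F_eq hp.1 hy).trans_le (B.le_upperValue p μ hp)
  have e3 := (B.lowerValue_le p hμ₀).trans (hmax p hp)
  have e4 : B.F p₀ μ₀ ≤ B.upperValue p μ :=
    (hmin μ hμ).trans ((B.F_le hp₀.1 hμ.1 fun x => (hy x).1.1).trans (B.le_upperValue p μ hp₀))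
  rw [abs_le]
  constructor <;> linarith


end

end LinearBandit


/-! ### The main theorem -/

theorem theorem5 {K d : ℕ} (hK : 2 ≤ K) (B : LinearBandit K d) :
    (∃ M : ℝ, B.IsGradientBound M) ∧
    (∀ M : ℝ, B.IsGradientBound M →
      ∃ Tbar : ℝ, ∀ (p : ℝ → Fin K → ℝ) (μ : ℝ → B.Scenario → ℝ), B.IsSolution p μ →
        ∃ (r : ℕ) (S : ℕ → Submodule ℝ (EuclideanSpace ℝ (Fin d))) (τ : ℕ → ℝ),
          -- the chain of spans
          S 0 = B.activeSpan (p 0) ∧ (∀ l < r, S l < S (l + 1)) ∧ S r = B.fullSpan ∧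
          r ≤ Module.finrank ℝ (Submodule.span ℝ (Set.range B.delta)) ∧
          Module.finrank ℝ (Submodule.span ℝ (Set.range B.delta)) ≤
            Module.finrank ℝ B.fullSpan ∧
          (r = 0 ↔ B.zeroInfo (p 0) = ∅) ∧
          -- the expansion times and the epochs
          τ 0 = 0 ∧ 0 ≤ τ 1 ∧ (∀ l, 1 ≤ l → l < r → τ l < τ (l + 1)) ∧
          (∀ l < r, ∀ t ∈ Set.Ioc (τ l) (τ (l + 1)),
            B.activeSpan (p t) = S l ∧ (B.zeroInfo (p t)).Nonempty) ∧
          (∀ t, τ r < t → B.activeSpan (p t) = B.fullSpan) ∧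
          (∀ l < r, τ (l + 1) - τ l ≤ B.timeS M (S l) + Real.log 2) ∧
          -- after the total time
          B.timeStar M r S ≤ Tbar ∧
          (∀ t, B.timeStar M r S ≤ t →
            B.activeSpan (p t) = B.fullSpan ∧ B.zeroInfo (p t) = ∅ ∧
            (∀ x, 0 < B.D (p t) x) ∧ (p t, μ t) ∈ B.diffSet)) ∧
    -- uniform convergence of the game value
    (∃ (pstar : Fin K → ℝ) (mustar : B.Scenario → ℝ), B.IsNash pstar mustar ∧
      ∀ ε > 0, ∃ T : ℝ, ∀ (p : ℝ → Fin K → ℝ) (μ : ℝ → B.Scenario → ℝ), B.IsSolution p μ →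
        ∀ t ≥ T, |B.F (p t) (μ t) - B.F pstar mustar| ≤ ε) := by
  have : Nontrivial (Fin K) := Fin.nontrivial_iff_two_le.2 hK
  obtain ⟨x₀, hx₀⟩ := exists_ne B.best
  have : Nonempty B.Scenario := ⟨⟨x₀, hx₀⟩⟩
  have hepochs := fun (M : ℝ) (hM : B.IsGradientBound M) (C : ℝ) (hC0 : 0 ≤ C)
    (hC : ∀ p : Fin K → ℝ, B.timeS M (B.activeSpan p) + Real.log 2 ≤ C)
    (p : ℝ → Fin K → ℝ) (μ : ℝ → B.Scenario → ℝ) (h : B.IsSolution p μ) =>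
    h.exists_epochs hM hC0 hC
  refine ⟨B.exists_isGradientBound, fun M hM => ?_, ?_⟩
  · obtain ⟨C, hC0, hC⟩ := B.exists_bound_timeS M
    exact ⟨_, hepochs M hM C hC0 hC⟩
  · obtain ⟨M, hM⟩ := B.exists_isGradientBound
    obtain ⟨C, hC0, hC⟩ := B.exists_bound_timeS M
    obtain ⟨pstar, mustar, hN⟩ := B.exists_isNash
    refine ⟨pstar, mustar, hN, fun ε hε => ?_⟩
    -- A time, common to all solutions, from which the active span is full.
    set a : ℝ := Module.finrank ℝ B.fullSpan * C with ha_def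
    have ha : 0 ≤ a := by positivity
    set R : ℝ := ∑ i, B.radius ^ 2 / (2 * (B.σ i : ℝ) ^ 2) with hR
    have hlim : Filter.Tendsto (fun t : ℝ => Real.exp (a - t) * R) Filter.atTop (nhds (0 * R)) :=
      (Real.tendsto_exp_atBot.comp
        (Filter.tendsto_atBot_add_const_left _ a Filter.tendsto_neg_atTop_atBot)).mul_const R
    rw [zero_mul] at hlim
    obtain ⟨T, hT⟩ := Filter.eventually_atTop.1 (hlim.eventually (gt_mem_nhds hε))
    refine ⟨max T a, fun p μ h t ht => ?_⟩
    have hta : a ≤ t := (le_max_right _ _).trans ht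
    have ht0 := ha.trans hta
    obtain ⟨r, S, τ, -, -, -, -, -, -, -, -, -, -, -, -, hstar, hfin⟩ :=
      hepochs M hM C hC0 hC p μ h
    have hS := (hfin a hstar).1
    have hgap := h.exp_mul_gap_le ha hta hS
    -- At time `a` the gap is at most `R` for every solution, so the decay from there is uniform.
    have hlow : 0 ≤ B.lowerValue (p a) := Real.iInf_nonneg fun x => B.D_nonneg (h.mem_p a ha).1 x
    have hup := B.upperValue_le (h.mem_p a ha).1 (h.mem_mu a ha)
    refine (B.abs_F_sub_le hN (h.mem_p t ht0) (h.mem_mu t ht0)).trans ?_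
    refine le_trans ?_ (hT t ((le_max_left _ _).trans ht)).le
    rw [Real.exp_sub, div_mul_eq_mul_div, le_div_iff₀ (Real.exp_pos t)]
    have : Real.exp a * (B.upperValue (p a) (μ a) - B.lowerValue (p a)) ≤ Real.exp a * R :=
      mul_le_mul_of_nonneg_left (by linarith) (Real.exp_pos a).le
    linarith
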